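/- Let $d\in\{1,2,3\}$ and $\tfrac12<b\le b'<\min\{\tfrac{6-d}{4},1\}$. For $\xi\in\mathbb R^d$ write $\|\xi\|=\sum_{i=1}^d|\xi_i|$, let $|\xi|$ be the Euclidean norm and $\langle\cdot\rangle=(1+|\cdot|^2)^{1/2}$, and let $e^{\pm\sigma\|D\|}$ be the Fourier multiplier in the space variable with symbol $e^{\pm\sigma\|\xi\|}$. Put $\widehat f(\tau,\xi)=\int_{\mathbb R^{1+d}}e^{-i(t\tau+x\cdot\xi)}f(t,x)\,dt\,dx$ (extended to tempered distributions) and $$\|f\|_{X^{s,b}}=\big\|\langle\xi\rangle^s\langle\tau+|\xi|^2\rangle^b\widehat f\big\|_{L^2_{\tau,\xi}},\qquad \|f\|_{X_\pm^{\sigma,s,b}}=\big\|e^{\sigma\|\xi\|}\langle\xi\rangle^s\langle\tau\pm|\xi|\rangle^b\widehat f\big\|_{L^2_{\tau,\xi}} .$$ There is a constant $C>0$ depending only on $d,b,b'$ such that for every $\sigma\ge0$, either choice of the sign $\pm$, every $v$ with $\|v\|_{X^{0,b}}<\infty$ and every $m$ with $\|m\|_{X_\pm^{\sigma,1,b}}<\infty$,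 the tempered distribution $$F(v,m)=vm-e^{\sigma\|D\|}\big(m\,e^{-\sigma\|D\|}v\big)$$ is well defined and $$\big\|\overline{F(v,m)}\big\|_{X^{0,b'-1}}\le C\,\sigma\,\|v\|_{X^{0,b}}\,\|m\|_{X_\pm^{\sigma,1,b}} .$$ -/

import Mathlib

open MeasureTheory SchwartzMap
open scoped ENNReal FourierTransform ComplexConjugate

noncomputable section

namespace GevreyBourgain

/-- Space-time `ℝ^{1+d}`, points `(t, x)`; also used for the dual variable `(τ, ξ)`. -/
abbrev Spacetime (d : ℕ) : Type := WithLp 2 (ℝ × EuclideanSpace ℝ (Fin d))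

/-- The bracket `⟨r⟩ = √(1 + r²)`. -/
def bracket (r : ℝ) : ℝ := Real.sqrt (1 + r ^ 2)

/-- `‖ξ‖ = ∑ᵢ |ξᵢ|`. -/
def l1norm {d : ℕ} (ξ : EuclideanSpace ℝ (Fin d)) : ℝ := ∑ i, |ξ i|

/-- The tempered distribution `f` is (integration against) the function `u`. -/
def IsFunction {d : ℕ} (f : 𝓢'(Spacetime d, ℂ)) (u : Spacetime d → ℂ) : Prop :=
  AEStronglyMeasurable u volume ∧
    ∀ φ : 𝓢(Spacetime d, ℂ),
      Integrable (fun z => φ z * u z) volume ∧ f φ = ∫ z, φ z * u z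

/-- The space-time Fourier transform of `f`, in the normalisation
`f̂(τ, ξ) = ∫ e^{-i(tτ + x·ξ)} f(t, x) dt dx`, is the function `g`. Mathlib's transform `𝓕` has the
kernel `e^{-2πi(tτ + x·ξ)}`, so that `𝓕 f (ζ) = f̂ (2πζ)`. -/
def HasFourier {d : ℕ} (f : 𝓢'(Spacetime d, ℂ)) (g : Spacetime d → ℂ) : Prop :=
  IsFunction (𝓕 f) (fun ζ => g ((2 * Real.pi) • ζ))

/-- `f' = a(D) f` for the spatial Fourier multiplier with symbol `a(ξ)`. -/
def IsMultiplier {d : ℕ} (a : EuclideanSpace ℝ (Fin d) → ℝ) (f f' : 𝓢'(Spacetime d, ℂ)) : Prop :=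
  ∃ g : Spacetime d → ℂ, HasFourier f g ∧ HasFourier f' (fun ζ => (a ζ.snd : ℂ) * g ζ)

/-- `f' = e^{σ‖D‖} f`, where `σ` may be negative. -/
def IsExpD {d : ℕ} (σ : ℝ) (f f' : 𝓢'(Spacetime d, ℂ)) : Prop :=
  IsMultiplier (fun ξ => Real.exp (σ * l1norm ξ)) f f'

/-- The norm `‖⟨ξ⟩^s ⟨τ - h(ξ)⟩^b f̂(τ, ξ)‖_{L²}`. The function `f̂` is unique up to null sets; the
value is `∞` if the Fourier transform of `f` is not a function. -/
def bourgainNorm {d : ℕ} (h : EuclideanSpace ℝ (Fin d) → ℝ) (s b : ℝ)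
    (f : 𝓢'(Spacetime d, ℂ)) : ℝ≥0∞ :=
  ⨅ (g : Spacetime d → ℂ) (_ : HasFourier f g),
    eLpNorm (fun ζ : Spacetime d =>
      ((bracket ‖ζ.snd‖ ^ s * bracket (ζ.fst - h ζ.snd) ^ b : ℝ) : ℂ) * g ζ) 2 volume

/-- The Gevrey-Bourgain norm `‖e^{σ‖D‖} f‖_{X_h^{s,b}}`; it is `∞` if `e^{σ‖D‖} f` is not a
tempered distribution. -/
def gevreyBourgainNorm {d : ℕ} (h : EuclideanSpace ℝ (Fin d) → ℝ) (σ s b : ℝ)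
    (f : 𝓢'(Spacetime d, ℂ)) : ℝ≥0∞ :=
  ⨅ (f' : 𝓢'(Spacetime d, ℂ)) (_ : IsExpD σ f f'), bourgainNorm h s b f'

/-- The phase `h(ξ) = -|ξ|²` of the spaces `X^{s,b}`. -/
def hSchr {d : ℕ} (ξ : EuclideanSpace ℝ (Fin d)) : ℝ := -‖ξ‖ ^ 2

/-- The two signs `±`. -/
inductive PM : Type
  | plus : PM
  | minus : PM

/-- The phase `h(ξ) = ∓|ξ|` of the spaces `X_±^{s,b}`. -/
def hWave {d : ℕ} : PM → EuclideanSpace ℝ (Fin d) → ℝ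
  | PM.plus, ξ => -‖ξ‖
  | PM.minus, ξ => ‖ξ‖

/-- `p` is the pointwise product of the distributions `f` and `g`, which are functions. -/
def IsProduct {d : ℕ} (f g p : 𝓢'(Spacetime d, ℂ)) : Prop :=
  ∃ u w : Spacetime d → ℂ, IsFunction f u ∧ IsFunction g w ∧ IsFunction p (fun z => u z * w z)

/-- `F = v m - e^{σ‖D‖} (m e^{-σ‖D‖} v)`, all the operations being defined. -/
def IsCommutator {d : ℕ} (σ : ℝ) (v m F : 𝓢'(Spacetime d, ℂ)) : Prop :=
  ∃ p w q r : 𝓢'(Spacetime d, ℂ),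
    IsProduct v m p ∧ IsExpD (-σ) v w ∧ IsProduct m w q ∧ IsExpD σ q r ∧ F = p - r

/-- Complex conjugation of Schwartz functions. -/
def conjSchwartz {d : ℕ} : 𝓢(Spacetime d, ℂ) →L[ℝ] 𝓢(Spacetime d, ℂ) :=
  SchwartzMap.postcompCLM (Complex.conjCLE : ℂ →L[ℝ] ℂ)

/-- The complex conjugate of a tempered distribution, `⟨f̄, φ⟩ = conj ⟨f, φ̄⟩`. -/
def conjDistribution {d : ℕ} (f : 𝓢'(Spacetime d, ℂ)) : 𝓢'(Spacetime d, ℂ) :=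
  ContinuousLinearMap.toPointwiseConvergenceCLM _ _ _ _
    { toFun := fun φ => conj (f (conjSchwartz φ))
      map_add' := fun φ ψ => by simp
      map_smul' := fun c φ => by
        have : conjSchwartz (c • φ) = conj c • conjSchwartz φ := by
          ext z
          simp [conjSchwartz]
        simp [this]
      cont := Complex.continuous_conj.comp (f.continuous.comp conjSchwartz.continuous) }

end GevreyBourgain

end

open GevreyBourgain

namespace GevreyBourgain

/-! Write (τ, ξ) for the output variable and (τ₁, ξ₁) for that of m. On the Fourier side F is, up to
a power of 2π, the integral of (1 - e^y) v̂(τ - τ₁, ξ - ξ₁) m̂(τ₁, ξ₁), where y = σ(`l1norm ξ` -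
`l1norm (ξ - ξ₁)`). The triangle inequality gives |y| ≤ σ `l1norm ξ₁`, and |1 - e^y| ≤ L e^L for |y|
≤ L. So the factor costs σ d ⟨ξ₁⟩ e^{σ `l1norm ξ₁`}, which is exactly the extra weight in the norm
of m. The same absorption makes all operations in F meaningful (`exists_isCommutator`).

There remains a bilinear estimate without σ (`lintegral_sq_schrodinger_wave_le`). Conjugation turns
the output weight into ⟨A⟩^{-a}, with A = τ - |ξ|² and a = 1 - b'; the inputs carry ⟨B⟩^b and ⟨D⟩^b,
with B = τ - τ₁ + |ξ - ξ₁|² and D = τ₁ - h(ξ₁). Then B + D - A = |ξ|² + |ξ - ξ₁|² - h(ξ₁). The two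
squares have the same sign and h is of first order, so the largest bracket Q controls |ξ|² + |ξ -
ξ₁|² (`resonance_identity_le`).

Since a ≤ b, the exponents can be exchanged so that Q carries -a and the other two brackets carry
-b. Cauchy–Schwarz is applied with the variable of Q fixed. The time integral of the two remaining
factors leaves ⟨f(ξ)⟩^{-2b} on a ball of radius about Q^{1/2}, where f grows quadratically along
rays. Polar coordinates bound this by Q^{(d-2)/2}, with d - 2 truncated at 0, and Q^{-2a}
compensates when d - 2 ≤ 4(1 - b'). This is the origin of the bound (6 - d)/4. -/

/-! ### Brackets and their integrals -/

theorem one_le_bracket (r : ℝ) : 1 ≤ bracket r :=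
  Real.one_le_sqrt.2 (by nlinarith [sq_nonneg r])

theorem bracket_pos (r : ℝ) : 0 < bracket r := one_pos.trans_le (one_le_bracket r)

theorem abs_le_bracket (r : ℝ) : |r| ≤ bracket r :=
  Real.abs_le_sqrt (by linarith)

theorem bracket_neg (r : ℝ) : bracket (-r) = bracket r := by simp [bracket]

theorem continuous_bracket : Continuous bracket := by unfold bracket; fun_prop

theorem bracket_le_bracket {r s : ℝ} (h : |r| ≤ |s|) : bracket r ≤ bracket s :=
  Real.sqrt_le_sqrt (by linarith [sq_le_sq.2 h])

theorem bracket_sub_le (r s : ℝ) : bracket (r - s) ≤ bracket r + bracket s := by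
  have hr := bracket_pos r
  have hs := bracket_pos s
  have hr2 : bracket r ^ 2 = 1 + r ^ 2 := Real.sq_sqrt (by positivity)
  have hs2 : bracket s ^ 2 = 1 + s ^ 2 := Real.sq_sqrt (by positivity)
  refine Real.sqrt_le_iff.2 ⟨by positivity, ?_⟩
  have h : -(r * s) ≤ bracket r * bracket s :=
    calc -(r * s) ≤ |r * s| := neg_le_abs _
      _ = |r| * |s| := abs_mul r s
      _ ≤ _ := mul_le_mul (abs_le_bracket r) (abs_le_bracket s) (abs_nonneg _) hr.le
  nlinarith

/-- The function `⟨r⟩ ^ p` with values in `[0, ∞]`. -/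
noncomputable def bracketPow (p r : ℝ) : ℝ≥0∞ := ENNReal.ofReal (bracket r ^ p)

theorem measurable_bracketPow (p : ℝ) : Measurable (bracketPow p) :=
  (continuous_bracket.measurable.pow_const p).ennreal_ofReal

theorem bracketPow_neg_arg (p r : ℝ) : bracketPow p (-r) = bracketPow p r := by
  simp [bracketPow, bracket_neg]

theorem bracketPow_anti {p r s : ℝ} (hp : 0 ≤ p) (h : |s| ≤ |r|) :
    bracketPow (-p) r ≤ bracketPow (-p) s :=
  ENNReal.ofReal_le_ofReal
    (Real.rpow_le_rpow_of_nonpos (bracket_pos s) (bracket_le_bracket h) (by linarith))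

theorem bracketPow_neg_le_one {p : ℝ} (hp : 0 ≤ p) (r : ℝ) : bracketPow (-p) r ≤ 1 := by
  simpa [bracketPow] using Real.rpow_le_one_of_one_le_of_nonpos (one_le_bracket r)
    (neg_nonpos.2 hp)

/-- Used with p = 2b: the condition b > 1/2 is what makes the constants of the bilinear estimate
finite. -/
theorem lintegral_bracketPow_lt_top {p : ℝ} (hp : 1 < p) : ∫⁻ r, bracketPow (-p) r < ∞ := by
  have h := (integrable_rpow_neg_one_add_norm_sq (E := ℝ) (μ := volume) (r := p)
    (by simpa using hp)).lintegral_lt_top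
  convert h using 4 with r
  simp only [bracketPow, bracket, Real.norm_eq_abs, sq_abs]
  rw [Real.sqrt_eq_rpow, ← Real.rpow_mul (by positivity)]
  congr 2
  ring

/-- Convolution of two brackets. -/
theorem lintegral_bracketPow_mul_le {p : ℝ} (hp : 0 ≤ p) (α β : ℝ) :
    ∫⁻ τ, bracketPow (-p) (τ - α) * bracketPow (-p) (τ - β) ≤
      ENNReal.ofReal (2 ^ p) * (2 * ∫⁻ r, bracketPow (-p) r) * bracketPow (-p) (α - β) := by
  have key : ∀ τ, bracketPow (-p) (τ - α) * bracketPow (-p) (τ - β) ≤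
      ENNReal.ofReal (2 ^ p) * bracketPow (-p) (α - β) *
        (bracketPow (-p) (τ - α) + bracketPow (-p) (τ - β)) := by
    intro τ
    -- The larger of the two brackets is at least half of ⟨α - β⟩, so its factor can be taken out at
    -- the cost of 2^p and the other factor is integrated.
    have big : ∀ x y z : ℝ, bracket z ≤ bracket x + bracket y → bracket x ≤ bracket y →
        bracketPow (-p) y ≤ ENNReal.ofReal (2 ^ p) * bracketPow (-p) z := by
      intro x y z h1 h2
      unfold bracketPow
      rw [← ENNReal.ofReal_mul (by positivity)]
      refine ENNReal.ofReal_le_ofReal ?_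
      have h3 : bracket z / 2 ≤ bracket y := by linarith
      have h4 := Real.rpow_le_rpow_of_nonpos (half_pos (bracket_pos z)) h3 (neg_nonpos.2 hp)
      rw [Real.div_rpow (bracket_pos z).le (by norm_num), Real.rpow_neg (x := 2) (by norm_num)]
        at h4
      simpa [div_eq_mul_inv, mul_comm] using h4
    have htri : bracket (α - β) ≤ bracket (τ - α) + bracket (τ - β) := by
      have := bracket_sub_le (τ - β) (τ - α)
      rw [show τ - β - (τ - α) = α - β by ring] at this
      linarith
    rcases le_total (bracket (τ - α)) (bracket (τ - β)) with h | h
    · calc _ ≤ bracketPow (-p) (τ - α) * (ENNReal.ofReal (2 ^ p) * bracketPow (-p) (α - β)) := by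
            gcongr; exact big _ _ _ htri h
        _ = ENNReal.ofReal (2 ^ p) * bracketPow (-p) (α - β) * bracketPow (-p) (τ - α) := by ring
        _ ≤ _ := by gcongr; exact le_self_add
    · calc _ ≤ (ENNReal.ofReal (2 ^ p) * bracketPow (-p) (α - β)) * bracketPow (-p) (τ - β) := by
            gcongr; exact big _ _ _ (by linarith) h
        _ ≤ _ := by gcongr; exact le_add_self
  have hm := measurable_bracketPow (-p)
  calc _ ≤ ∫⁻ τ, ENNReal.ofReal (2 ^ p) * bracketPow (-p) (α - β) *
        (bracketPow (-p) (τ - α) + bracketPow (-p) (τ - β)) := lintegral_mono key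
    _ = ENNReal.ofReal (2 ^ p) * bracketPow (-p) (α - β) *
        ((∫⁻ τ, bracketPow (-p) (τ - α)) + ∫⁻ τ, bracketPow (-p) (τ - β)) := by
      rw [lintegral_const_mul, lintegral_add_left]
      all_goals fun_prop
    _ = _ := by
      rw [lintegral_sub_right_eq_self (bracketPow (-p)),
        lintegral_sub_right_eq_self (bracketPow (-p))]
      ring

/-! ### Functions of quadratic growth along rays -/

/-- A function that grows at least like `r² / 2` on `[1, ∞)` is bounded below in absolute value by
the distance of `r²` to some `r₀²`. -/
theorem exists_abs_sq_sub_le {φ : ℝ → ℝ}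
    (hφ : ∀ s r, 1 ≤ s → s ≤ r → (r ^ 2 - s ^ 2) / 2 ≤ φ r - φ s) :
    ∃ r₀, ∀ r, 1 ≤ r → |(r ^ 2 - r₀ ^ 2) / 2| ≤ |φ r| := by
  by_cases hne : ∃ r, 1 ≤ r ∧ φ r ≤ 0
  · obtain ⟨r₁, hr₁, hφ₁⟩ := hne
    -- As φ need not be continuous, r₀ is not a zero of φ but the supremum of the points where φ ≤
    -- 0. Below r₀ the growth condition is compared with points of S, above it with points
    -- decreasing to r₀.
    set S : Set ℝ := {r | 1 ≤ r ∧ φ r ≤ 0} with hS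
    have hbdd : BddAbove S := by
      refine ⟨1 + 2 * |φ 1|, fun r hr => ?_⟩
      have := hφ 1 r le_rfl hr.1
      have h2 := hr.2
      have h3 := neg_abs_le (φ 1)
      have h4 := abs_nonneg (φ 1)
      by_contra! hlt
      nlinarith [hr.1]
    have hSne : S.Nonempty := ⟨r₁, hr₁, hφ₁⟩
    have h1 : 1 ≤ sSup S := hr₁.trans (le_csSup hbdd ⟨hr₁, hφ₁⟩)
    refine ⟨sSup S, fun r hr => ?_⟩
    rcases lt_trichotomy r (sSup S) with h | h | h
    · have key : ∀ s ∈ S, s ^ 2 ≤ r ^ 2 - 2 * φ r := by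
        intro s hs
        rcases le_total r s with hrs | hrs
        · have := hφ r s hr hrs
          linarith [hs.2]
        · obtain ⟨t, ht, hrt⟩ := exists_lt_of_lt_csSup hSne h
          have := hφ r t hr hrt.le
          have := ht.2
          nlinarith [hs.1]
      have hle : sSup S ≤ √(r ^ 2 - 2 * φ r) :=
        csSup_le hSne fun s hs => Real.le_sqrt_of_sq_le (key s hs)
      have hnn : 0 ≤ r ^ 2 - 2 * φ r := (sq_nonneg _).trans (key r₁ ⟨hr₁, hφ₁⟩)
      have h5 : sSup S ^ 2 ≤ r ^ 2 - 2 * φ r := by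
        have := pow_le_pow_left₀ (by linarith) hle 2
        rwa [Real.sq_sqrt hnn] at this
      have h6 : r ^ 2 ≤ sSup S ^ 2 := by nlinarith
      rw [abs_of_nonpos (by linarith)]
      have := neg_le_abs (φ r)
      linarith
    · rw [h]; simp
    · have hpos : ∀ s, sSup S < s → 0 < φ s := by
        intro s hs
        by_contra! hc
        exact absurd (le_csSup hbdd ⟨by linarith, hc⟩) (not_le.2 hs)
      have key : ∀ s ∈ Set.Ioo (sSup S) r, r ^ 2 - 2 * φ r ≤ s ^ 2 := by
        intro s hs
        have := hφ s r (by linarith [hs.1]) hs.2.le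
        have := hpos s hs.1
        linarith
      have h5 : r ^ 2 - 2 * φ r ≤ sSup S ^ 2 := by
        have ht : Filter.Tendsto (fun s : ℝ => s ^ 2) (nhdsWithin (sSup S) (Set.Ioi (sSup S)))
            (nhds (sSup S ^ 2)) := ((continuous_pow 2).tendsto _).mono_left nhdsWithin_le_nhds
        exact ge_of_tendsto ht (by filter_upwards [Ioo_mem_nhdsGT h] with s hs using key s hs)
      rw [abs_of_nonneg (by nlinarith)]
      have := le_abs_self (φ r)
      linarith
  · push Not at hne
    -- If φ is positive on all of [1, ∞), its sign change lies to the left, and r₀ = 1 serves.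
    refine ⟨1, fun r hr => ?_⟩
    have h1 := hφ 1 r le_rfl hr
    have h2 := hne 1 le_rfl
    rw [abs_of_nonneg (by nlinarith)]
    have := le_abs_self (φ r)
    linarith

/-- After φ is replaced by ψ(r) = (r² - r₀²)/2, the factor r is the derivative of ψ, and r dr
becomes Lebesgue measure on the image of the ray. -/
theorem lintegral_ray_le {p : ℝ} (hp : 0 ≤ p) {φ : ℝ → ℝ}
    (hφ : ∀ s r, 1 ≤ s → s ≤ r → (r ^ 2 - s ^ 2) / 2 ≤ φ r - φ s) :
    ∫⁻ r in Set.Ioi 1, ENNReal.ofReal r * bracketPow (-p) (φ r) ≤ ∫⁻ r, bracketPow (-p) r := by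
  obtain ⟨r₀, hr₀⟩ := exists_abs_sq_sub_le hφ
  set ψ : ℝ → ℝ := fun r => (r ^ 2 - r₀ ^ 2) / 2
  have hinj : Set.InjOn ψ (Set.Ioi 1) := by
    intro x hx y hy h
    have hx : 1 < x := hx
    have hy : 1 < y := hy
    have h : (x ^ 2 - r₀ ^ 2) / 2 = (y ^ 2 - r₀ ^ 2) / 2 := h
    have h2 : x ^ 2 = y ^ 2 := by linarith
    exact (pow_left_inj₀ (by linarith) (by linarith) two_ne_zero).1 h2
  have hder : ∀ x ∈ Set.Ioi (1 : ℝ), HasDerivWithinAt ψ x (Set.Ioi 1) x := by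
    intro x _
    have h := ((hasDerivAt_pow 2 x).sub_const (r₀ ^ 2)).div_const 2
    rw [show ((2 : ℕ) : ℝ) * x ^ (2 - 1) / 2 = x by norm_num] at h
    exact h.hasDerivWithinAt
  calc _ ≤ ∫⁻ r in Set.Ioi 1, ENNReal.ofReal |r| * bracketPow (-p) (ψ r) := by
        refine setLIntegral_mono' measurableSet_Ioi fun r hr => ?_
        exact mul_le_mul' (ENNReal.ofReal_le_ofReal (le_abs_self r))
          (bracketPow_anti hp (hr₀ r (le_of_lt hr)))
    _ = ∫⁻ x in ψ '' Set.Ioi 1, bracketPow (-p) x :=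
        (lintegral_image_eq_lintegral_abs_deriv_mul measurableSet_Ioi hder hinj _).symm
    _ ≤ _ := setLIntegral_le_lintegral _ _

/-- Integration in polar coordinates. -/
theorem lintegral_eq_lintegral_sphere {E : Type*} [NormedAddCommGroup E] [NormedSpace ℝ E]
    [FiniteDimensional ℝ E] [Nontrivial E] [MeasurableSpace E] [BorelSpace E] (μ : Measure E)
    [μ.IsAddHaarMeasure] {f : E → ℝ≥0∞} (hf : Measurable f) :
    ∫⁻ x, f x ∂μ = ∫⁻ ω : Metric.sphere (0 : E) 1, ∫⁻ r in Set.Ioi (0 : ℝ),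
      ENNReal.ofReal (r ^ (Module.finrank ℝ E - 1)) * f (r • (ω : E)) ∂volume ∂μ.toSphere := by
  have h1 : ∫⁻ x, f x ∂μ = ∫⁻ x : ({(0 : E)}ᶜ : Set E), f x ∂(μ.comap (↑)) := by
    rw [lintegral_subtype_comap (measurableSet_singleton _).compl, restrict_compl_singleton]
  set g : Metric.sphere (0 : E) 1 × Set.Ioi (0 : ℝ) → ℝ≥0∞ := fun y => f ((y.2 : ℝ) • (y.1 : E))
  have hg : Measurable g := by fun_prop
  have h2 : ∫⁻ x : ({(0 : E)}ᶜ : Set E), f x ∂(μ.comap (↑)) =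
      ∫⁻ y, g y ∂(μ.toSphere.prod (.volumeIoiPow (Module.finrank ℝ E - 1))) := by
    rw [← μ.measurePreserving_homeomorphUnitSphereProd.lintegral_comp hg]
    refine lintegral_congr fun x => ?_
    have hx : ‖(x : E)‖ ≠ 0 := norm_ne_zero_iff.2 x.2
    simp [g, smul_smul, hx]
  rw [h1, h2, lintegral_prod _ hg.aemeasurable]
  refine lintegral_congr fun ω => ?_
  rw [Measure.volumeIoiPow, lintegral_withDensity_eq_lintegral_mul _ (by fun_prop)
    (by fun_prop)]
  exact lintegral_subtype_comap measurableSet_Ioi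
    (fun r : ℝ => ENNReal.ofReal (r ^ (Module.finrank ℝ E - 1)) * f (r • (ω : E)))

/-- Let `f` grow at least like `‖x‖² / 2` on rays outside the unit ball. The neighbourhood of the
zero set of `f` in the ball of radius `N` then has measure `O(N^{d-2})`, in the sense that
the integral of `⟨f⟩^{-p}` with `p > 1` has this order. -/
theorem lintegral_closedBall_bracketPow_le {d : ℕ} (hd : d ≠ 0) {p : ℝ} (hp : 0 ≤ p)
    {f : EuclideanSpace ℝ (Fin d) → ℝ} (hf : Measurable f)
    (hgrow : ∀ ω : EuclideanSpace ℝ (Fin d), ‖ω‖ = 1 → ∀ s r : ℝ, 1 ≤ s → s ≤ r →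
      (r ^ 2 - s ^ 2) / 2 ≤ f (r • ω) - f (s • ω)) {N : ℝ} (hN : 1 ≤ N) :
    ∫⁻ x in {x | ‖x‖ ≤ N}, bracketPow (-p) (f x) ≤
      (volume : Measure (EuclideanSpace ℝ (Fin d))).toSphere Set.univ *
        (1 + ∫⁻ r, bracketPow (-p) r) * ENNReal.ofReal (N ^ (d - 2)) := by
  have : Nonempty (Fin d) := ⟨⟨0, Nat.pos_of_ne_zero hd⟩⟩
  have hS : MeasurableSet {x : EuclideanSpace ℝ (Fin d) | ‖x‖ ≤ N} :=
    measurableSet_le measurable_norm measurable_const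
  have hm := measurable_bracketPow (-p)
  rw [← lintegral_indicator hS, lintegral_eq_lintegral_sphere _ (by measurability)]
  set I := ∫⁻ r, bracketPow (-p) r
  have key : ∀ ω : Metric.sphere (0 : EuclideanSpace ℝ (Fin d)) 1,
      (∫⁻ r in Set.Ioi (0 : ℝ), ENNReal.ofReal
        (r ^ (Module.finrank ℝ (EuclideanSpace ℝ (Fin d)) - 1)) *
        {x | ‖x‖ ≤ N}.indicator (fun x => bracketPow (-p) (f x))
          (r • (ω : EuclideanSpace ℝ (Fin d)))) ≤ (1 + I) * ENNReal.ofReal (N ^ (d - 2)) := by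
    intro ω
    have hω : ‖(ω : EuclideanSpace ℝ (Fin d))‖ = 1 := by simp
    have hray := lintegral_ray_le hp (hgrow ω hω)
    have hN1 : 1 ≤ N ^ (d - 2) := one_le_pow₀ hN
    -- The growth condition says nothing on r < 1; there the integrand is at most 1, which gives the
    -- summand 1 in 1 + I.
    rw [← Set.Ioc_union_Ioi_eq_Ioi (zero_le_one' ℝ)]
    refine (lintegral_union_le _ _ _).trans ?_
    rw [add_mul]
    refine add_le_add ?_ ?_
    · calc _ ≤ ∫⁻ r in Set.Ioc (0 : ℝ) 1, 1 := by
            refine setLIntegral_mono' measurableSet_Ioc fun r hr => ?_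
            refine mul_le_one' ?_ ?_
            · exact ENNReal.ofReal_le_one.2 (pow_le_one₀ hr.1.le hr.2)
            · refine Set.indicator_apply_le' (fun _ => bracketPow_neg_le_one hp _)
                fun _ => zero_le_one
        _ ≤ _ := by simpa using hN1
    · calc _ ≤ ∫⁻ r in Set.Ioi (1 : ℝ), ENNReal.ofReal (N ^ (d - 2)) *
            (ENNReal.ofReal r * bracketPow (-p) (f (r • (ω : EuclideanSpace ℝ (Fin d))))) := by
            refine setLIntegral_mono' measurableSet_Ioi fun r hr => ?_
            have hr : 1 < r := hr
            by_cases hrN : r ≤ N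
            · rw [← mul_assoc, ← ENNReal.ofReal_mul (by positivity)]
              refine mul_le_mul' (ENNReal.ofReal_le_ofReal ?_) (Set.indicator_le_self _ _ _)
              rw [finrank_euclideanSpace_fin]
              -- The aim is r^(d-1) ≤ N^(d-2) r. For d = 1 the exponent d - 2 is truncated to 0 and
              -- r ≥ 1 suffices.
              rcases Nat.lt_or_ge d 2 with h | h
              · have : d = 1 := by omega
                subst this
                simpa using hr.le
              · have : d - 1 = d - 2 + 1 := by omega
                rw [this, pow_succ]
                gcongr
            · have : ¬ ‖r • (ω : EuclideanSpace ℝ (Fin d))‖ ≤ N := by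
                rw [norm_smul, hω, mul_one, Real.norm_eq_abs, abs_of_pos (by linarith)]
                exact hrN
              rw [Set.indicator_of_notMem (by simpa using this)]
              simp
        _ = ENNReal.ofReal (N ^ (d - 2)) * ∫⁻ r in Set.Ioi (1 : ℝ),
            (ENNReal.ofReal r * bracketPow (-p) (f (r • (ω : EuclideanSpace ℝ (Fin d))))) :=
            lintegral_const_mul _ (by fun_prop)
        _ ≤ _ := by rw [mul_comm]; gcongr
  calc _ ≤ ∫⁻ _ : Metric.sphere (0 : EuclideanSpace ℝ (Fin d)) 1,
        (1 + I) * ENNReal.ofReal (N ^ (d - 2)) ∂(volume : Measure _).toSphere := lintegral_mono key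
    _ = _ := by rw [lintegral_const]; ring

/-! ### The space-time integral over a resonant region -/

theorem measurable_fst_spacetime {d : ℕ} : Measurable fun ζ : Spacetime d => ζ.fst :=
  (WithLp.prod_continuous_ofLp 2 ℝ (EuclideanSpace ℝ (Fin d))).measurable.fst

theorem measurable_snd_spacetime {d : ℕ} : Measurable fun ζ : Spacetime d => ζ.snd :=
  (WithLp.prod_continuous_ofLp 2 ℝ (EuclideanSpace ℝ (Fin d))).measurable.snd

theorem lintegral_spacetime {d : ℕ} {f : ℝ × EuclideanSpace ℝ (Fin d) → ℝ≥0∞}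
    (hf : Measurable f) :
    ∫⁻ ζ : Spacetime d, f (ζ.fst, ζ.snd) = ∫⁻ ξ, ∫⁻ τ, f (τ, ξ) := by
  rw [← lintegral_prod_symm _ hf.aemeasurable]
  exact (WithLp.volume_preserving_ofLp ℝ (EuclideanSpace ℝ (Fin d))).lintegral_comp hf

/-- The constant in `lintegral_resonance_le`. -/
noncomputable def resonanceConst (d : ℕ) (p : ℝ) : ℝ≥0∞ :=
  ENNReal.ofReal (2 ^ p) * (2 * ∫⁻ r, bracketPow (-p) r) *
    ((volume : Measure (EuclideanSpace ℝ (Fin d))).toSphere Set.univ *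
      (1 + ∫⁻ r, bracketPow (-p) r) * ENNReal.ofReal (3 ^ (d - 2)))

theorem resonanceConst_lt_top (d : ℕ) {p : ℝ} (hp : 1 < p) : resonanceConst d p < ∞ := by
  have hI := lintegral_bracketPow_lt_top hp
  unfold resonanceConst
  refine ENNReal.mul_lt_top (ENNReal.mul_lt_top ENNReal.ofReal_lt_top
    (ENNReal.mul_lt_top (by simp) hI)) (ENNReal.mul_lt_top (ENNReal.mul_lt_top
      (measure_lt_top _ _) (by simpa using hI)) ENNReal.ofReal_lt_top)

/-- Integrating in τ leaves ⟨α - β⟩^{-p}, and the frequency integral over the ball about `c` is then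
the one in polar coordinates. Here Q stands for the largest bracket, and `ha` turns the resulting
Q^{(d-2)/2} into the power Q^{2a} that its weight can pay for. -/
theorem lintegral_resonance_le {d : ℕ} (hd : d ≠ 0) {p a : ℝ} (hp : 0 ≤ p)
    (ha : ((d - 2 : ℕ) : ℝ) ≤ 4 * a) {α β : EuclideanSpace ℝ (Fin d) → ℝ} (hα : Measurable α)
    (hβ : Measurable β) (c : EuclideanSpace ℝ (Fin d))
    (hgrow : ∀ ω : EuclideanSpace ℝ (Fin d), ‖ω‖ = 1 → ∀ s r : ℝ, 1 ≤ s → s ≤ r →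
      (r ^ 2 - s ^ 2) / 2 ≤ (α (r • ω + c) - β (r • ω + c)) - (α (s • ω + c) - β (s • ω + c)))
    {Q : ℝ} (hQ : 1 ≤ Q) :
    ∫⁻ ζ : Spacetime d, {ζ : Spacetime d | ‖ζ.snd - c‖ ^ 2 ≤ 8 * Q}.indicator (fun ζ =>
      bracketPow (-p) (ζ.fst - α ζ.snd) * bracketPow (-p) (ζ.fst - β ζ.snd)) ζ ≤
      resonanceConst d p * ENNReal.ofReal (Q ^ (2 * a)) := by
  have hm := measurable_bracketPow (-p)
  set S : Set (EuclideanSpace ℝ (Fin d)) := {ξ | ‖ξ - c‖ ^ 2 ≤ 8 * Q} with hS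
  have hSm : MeasurableSet S := measurableSet_le (by fun_prop) measurable_const
  set g : EuclideanSpace ℝ (Fin d) → ℝ≥0∞ := fun x =>
    bracketPow (-p) (α (x + c) - β (x + c)) with hg
  set I := ∫⁻ r, bracketPow (-p) r with hI
  -- The radius comes from √8 ≤ 3.
  have hball := lintegral_closedBall_bracketPow_le hd hp
    (f := fun x => α (x + c) - β (x + c)) (by fun_prop) hgrow (N := 3 * √Q)
    (by nlinarith [Real.one_le_sqrt.2 hQ])
  have hpow : (3 * √Q) ^ (d - 2) ≤ 3 ^ (d - 2) * Q ^ (2 * a) := by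
    rw [mul_pow]
    gcongr
    rw [Real.sqrt_eq_rpow, ← Real.rpow_natCast, ← Real.rpow_mul (by linarith)]
    exact Real.rpow_le_rpow_of_exponent_le hQ (by linarith)
  calc _ = ∫⁻ ζ : Spacetime d, (fun x : ℝ × EuclideanSpace ℝ (Fin d) => S.indicator 1 x.2 *
          (bracketPow (-p) (x.1 - α x.2) * bracketPow (-p) (x.1 - β x.2))) (ζ.fst, ζ.snd) := by
        refine lintegral_congr fun ζ => ?_
        by_cases h : ‖ζ.snd - c‖ ^ 2 ≤ 8 * Q
        · simp [hS, Set.indicator, h]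
        · simp [hS, Set.indicator, h]
    _ = ∫⁻ ξ, ∫⁻ τ, S.indicator 1 ξ *
          (bracketPow (-p) (τ - α ξ) * bracketPow (-p) (τ - β ξ)) := by
        refine lintegral_spacetime (f := fun x : ℝ × EuclideanSpace ℝ (Fin d) =>
          S.indicator 1 x.2 *
            (bracketPow (-p) (x.1 - α x.2) * bracketPow (-p) (x.1 - β x.2))) ?_
        have : Measurable (S.indicator (1 : EuclideanSpace ℝ (Fin d) → ℝ≥0∞)) :=
          measurable_one.indicator hSm
        fun_prop
    _ ≤ ∫⁻ ξ, ENNReal.ofReal (2 ^ p) * (2 * I) * S.indicator (fun ξ => g (ξ - c)) ξ := by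
        refine lintegral_mono fun ξ => ?_
        rw [lintegral_const_mul _ (by fun_prop)]
        by_cases h : ξ ∈ S
        · simpa [h, hg] using lintegral_bracketPow_mul_le hp (α ξ) (β ξ)
        · simp [h]
    _ = ENNReal.ofReal (2 ^ p) * (2 * I) * ∫⁻ x in {x | ‖x‖ ^ 2 ≤ 8 * Q}, g x := by
        rw [lintegral_const_mul]
        · congr 1
          rw [← lintegral_indicator (measurableSet_le (by fun_prop) measurable_const),
            ← lintegral_sub_right_eq_self ({x | ‖x‖ ^ 2 ≤ 8 * Q}.indicator g) c]
          rfl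
        · refine Measurable.indicator ?_ hSm
          fun_prop
    _ ≤ ENNReal.ofReal (2 ^ p) * (2 * I) * ∫⁻ x in {x | ‖x‖ ≤ 3 * √Q}, g x := by
        refine mul_le_mul' le_rfl (lintegral_mono_set fun x hx => ?_)
        have hx : ‖x‖ ^ 2 ≤ 8 * Q := hx
        refine (pow_le_pow_iff_left₀ (norm_nonneg x) (by positivity) two_ne_zero).1 ?_
        rw [mul_pow, Real.sq_sqrt (by linarith)]
        linarith
    _ ≤ ENNReal.ofReal (2 ^ p) * (2 * I) *
          ((volume : Measure (EuclideanSpace ℝ (Fin d))).toSphere Set.univ * (1 + I) *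
            (ENNReal.ofReal (3 ^ (d - 2)) * ENNReal.ofReal (Q ^ (2 * a)))) := by
        gcongr
        refine hball.trans ?_
        gcongr
        rw [← ENNReal.ofReal_mul (by positivity)]
        exact ENNReal.ofReal_le_ofReal hpow
    _ = _ := by
        rw [resonanceConst]
        ring

/-! ### Bilinear operators with square integrable kernels -/

theorem sq_lintegral_mul_le {α : Type*} [MeasurableSpace α] {μ : Measure α} {f g : α → ℝ≥0∞}
    (hf : AEMeasurable f μ) (hg : AEMeasurable g μ) :
    (∫⁻ x, f x * g x ∂μ) ^ 2 ≤ (∫⁻ x, f x ^ 2 ∂μ) * ∫⁻ x, g x ^ 2 ∂μ := by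
  have h := ENNReal.lintegral_mul_le_Lp_mul_Lq μ Real.HolderConjugate.two_two hf hg
  have h2 := pow_le_pow_left' h 2
  rw [mul_pow, ← ENNReal.rpow_mul_natCast, ← ENNReal.rpow_mul_natCast] at h2
  simpa using h2

theorem add_add_sq_le (x y z : ℝ≥0∞) : (x + y + z) ^ 2 ≤ 9 * (x ^ 2 + y ^ 2 + z ^ 2) := by
  have h : ∀ w, x ≤ w → y ≤ w → z ≤ w → (x + y + z) ^ 2 ≤ 9 * w ^ 2 := by
    intro w hx hy hz
    calc (x + y + z) ^ 2 ≤ (w + w + w) ^ 2 := by gcongr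
      _ = 9 * w ^ 2 := by ring
  rcases le_total x y with h1 | h1 <;> rcases le_total y z with h2 | h2 <;>
    rcases le_total x z with h3 | h3
  all_goals first
    | exact (h z (by assumption) (by assumption) le_rfl).trans (by gcongr; exact le_add_self)
    | exact (h y (by assumption) le_rfl (by assumption)).trans
        (by gcongr; exact le_add_self.trans le_self_add)
    | exact (h x le_rfl (by assumption) (by assumption)).trans
        (by gcongr; exact le_self_add.trans le_self_add)
    | exact (h z (h1.trans h2) h2 le_rfl).trans (by gcongr; exact le_add_self)
    | exact (h x le_rfl h1 (h2.trans h1)).trans (by gcongr; exact le_self_add.trans le_self_add)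

section Bilinear

variable {G : Type*} [AddCommGroup G] [MeasurableSpace G] [MeasurableAdd₂ G] [MeasurableNeg G]
  {μ : Measure G} [SFinite μ] [μ.IsAddLeftInvariant]

/-- Bound for a bilinear operator whose kernel is square integrable for fixed output. -/
theorem lintegral_sq_bilinear_le_of_out {K : G → G → ℝ≥0∞}
    (hK : Measurable fun x : G × G => K x.1 x.2)
    {V M : G → ℝ≥0∞} (hV : Measurable V) (hM : Measurable M) {C : ℝ≥0∞}
    (hC : ∀ ζ, ∫⁻ η, K ζ η ^ 2 ∂μ ≤ C) :
    ∫⁻ ζ, (∫⁻ η, K ζ η * (V (ζ - η) * M η) ∂μ) ^ 2 ∂μ ≤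
      C * (∫⁻ ζ, V ζ ^ 2 ∂μ) * ∫⁻ η, M η ^ 2 ∂μ := by
  have hK' : ∀ ζ, Measurable (K ζ) := fun ζ => hK.comp measurable_prodMk_left
  calc _ ≤ ∫⁻ ζ, C * ∫⁻ η, V (ζ - η) ^ 2 * M η ^ 2 ∂μ ∂μ := by
        refine lintegral_mono fun ζ => ?_
        refine (sq_lintegral_mul_le (hK' ζ).aemeasurable (by fun_prop)).trans ?_
        simp_rw [mul_pow]
        gcongr
        exact hC ζ
    _ = C * ∫⁻ η, ∫⁻ ζ, V (ζ - η) ^ 2 * M η ^ 2 ∂μ ∂μ := by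
        rw [lintegral_const_mul _ (by fun_prop), lintegral_lintegral_swap (by fun_prop)]
    _ = C * ∫⁻ η, (∫⁻ ζ, V ζ ^ 2 ∂μ) * M η ^ 2 ∂μ := by
        congr 1
        refine lintegral_congr fun η => ?_
        rw [lintegral_mul_const _ (by fun_prop), lintegral_sub_right_eq_self (fun ζ => V ζ ^ 2) η]
    _ = _ := by rw [lintegral_const_mul _ (by fun_prop), mul_assoc]

variable [μ.IsNegInvariant]

/-- Bound for a bilinear operator whose kernel is square integrable for fixed second input. -/
theorem lintegral_sq_bilinear_le_of_right {K : G → G → ℝ≥0∞}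
    (hK : Measurable fun x : G × G => K x.1 x.2)
    {V M : G → ℝ≥0∞} (hV : Measurable V) (hM : Measurable M) {C : ℝ≥0∞}
    (hC : ∀ η, ∫⁻ ζ, K ζ η ^ 2 ∂μ ≤ C) :
    ∫⁻ ζ, (∫⁻ η, K ζ η * (V (ζ - η) * M η) ∂μ) ^ 2 ∂μ ≤
      C * (∫⁻ ζ, V ζ ^ 2 ∂μ) * ∫⁻ η, M η ^ 2 ∂μ := by
  have hK' : ∀ ζ, Measurable (K ζ) := fun ζ => hK.comp measurable_prodMk_left
  have hK'' : ∀ η, Measurable fun ζ => K ζ η := fun η => hK.comp measurable_prodMk_right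
  calc _ ≤ ∫⁻ ζ, (∫⁻ ζ, V ζ ^ 2 ∂μ) * ∫⁻ η, K ζ η ^ 2 * M η ^ 2 ∂μ ∂μ := by
        refine lintegral_mono fun ζ => ?_
        -- V is separated from K M: its norm does not depend on ζ, so after exchanging the integrals
        -- only K² is integrated in ζ.
        have h := sq_lintegral_mul_le (μ := μ) (f := fun η => V (ζ - η)) (g := fun η => K ζ η * M η)
          (by fun_prop) ((hK' ζ).mul hM).aemeasurable
        rw [lintegral_sub_left_eq_self (fun ζ => V ζ ^ 2) ζ] at h
        simp_rw [mul_pow] at h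
        refine le_trans (le_of_eq ?_) h
        congr 1
        exact lintegral_congr fun η => by ring
    _ = (∫⁻ ζ, V ζ ^ 2 ∂μ) * ∫⁻ η, ∫⁻ ζ, K ζ η ^ 2 * M η ^ 2 ∂μ ∂μ := by
        rw [lintegral_const_mul _ (by fun_prop), lintegral_lintegral_swap (by fun_prop)]
    _ ≤ (∫⁻ ζ, V ζ ^ 2 ∂μ) * ∫⁻ η, C * M η ^ 2 ∂μ := by
        gcongr with η
        rw [lintegral_mul_const _ ((hK'' η).pow_const 2)]
        gcongr
        exact hC η
    _ = _ := by rw [lintegral_const_mul _ (by fun_prop)]; ring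

/-- Bound for a bilinear operator whose kernel is square integrable for fixed first input. -/
theorem lintegral_sq_bilinear_le_of_left {K : G → G → ℝ≥0∞}
    (hK : Measurable fun x : G × G => K x.1 x.2)
    {V M : G → ℝ≥0∞} (hV : Measurable V) (hM : Measurable M) {C : ℝ≥0∞}
    (hC : ∀ η, ∫⁻ ζ, K ζ (ζ - η) ^ 2 ∂μ ≤ C) :
    ∫⁻ ζ, (∫⁻ η, K ζ η * (V (ζ - η) * M η) ∂μ) ^ 2 ∂μ ≤
      C * (∫⁻ ζ, V ζ ^ 2 ∂μ) * ∫⁻ η, M η ^ 2 ∂μ := by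
  -- The substitution η ↦ ζ - η exchanges the roles of the two inputs.
  have h := lintegral_sq_bilinear_le_of_right (μ := μ) (K := fun ζ η => K ζ (ζ - η))
    (hK.comp (measurable_fst.prodMk (measurable_fst.sub measurable_snd))) hM hV hC
  rw [mul_right_comm]
  refine le_trans (le_of_eq ?_) h
  refine lintegral_congr fun ζ => ?_
  rw [← lintegral_sub_left_eq_self _ ζ]
  congr 1
  refine lintegral_congr fun η => ?_
  rw [sub_sub_cancel, mul_comm (V η)]

/-- A weighted convolution estimate, for a product of weights that splits into three kernels, each
square integrable in one of the three ways. -/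
theorem lintegral_sq_weighted_le {A' B B' D D' : G → ℝ≥0∞} (hB : Measurable B) (hD : Measurable D)
    (hBB : ∀ ζ, B' ζ * B ζ = 1) (hDD : ∀ ζ, D' ζ * D ζ = 1)
    {K₁ K₂ K₃ : G → G → ℝ≥0∞} (hK₁ : Measurable fun x : G × G => K₁ x.1 x.2)
    (hK₂ : Measurable fun x : G × G => K₂ x.1 x.2) (hK₃ : Measurable fun x : G × G => K₃ x.1 x.2)
    (hsplit : ∀ ζ η, A' ζ * (B' (ζ - η) * D' η) ≤ K₁ ζ η + K₂ ζ η + K₃ ζ η)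
    {C : ℝ≥0∞} (hC₁ : ∀ ζ, ∫⁻ η, K₁ ζ η ^ 2 ∂μ ≤ C) (hC₂ : ∀ η, ∫⁻ ζ, K₂ ζ (ζ - η) ^ 2 ∂μ ≤ C)
    (hC₃ : ∀ η, ∫⁻ ζ, K₃ ζ η ^ 2 ∂μ ≤ C) {V M : G → ℝ≥0∞} (hV : Measurable V)
    (hM : Measurable M) :
    ∫⁻ ζ, (A' ζ * ∫⁻ η, V (ζ - η) * M η ∂μ) ^ 2 ∂μ ≤
      27 * C * (∫⁻ ζ, (B ζ * V ζ) ^ 2 ∂μ) * ∫⁻ η, (D η * M η) ^ 2 ∂μ := by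
  have hvm : Measurable fun ζ => B ζ * V ζ := hB.mul hV
  have hmm : Measurable fun ζ => D ζ * M ζ := hD.mul hM
  have h₁ := lintegral_sq_bilinear_le_of_out (μ := μ) hK₁ hvm hmm hC₁
  have h₂ := lintegral_sq_bilinear_le_of_left (μ := μ) hK₂ hvm hmm hC₂
  have h₃ := lintegral_sq_bilinear_le_of_right (μ := μ) hK₃ hvm hmm hC₃
  have hm₁ : ∀ ζ, Measurable (K₁ ζ) := fun ζ => hK₁.comp measurable_prodMk_left
  have hm₂ : ∀ ζ, Measurable (K₂ ζ) := fun ζ => hK₂.comp measurable_prodMk_left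
  have hm₃ : ∀ ζ, Measurable (K₃ ζ) := fun ζ => hK₃.comp measurable_prodMk_left
  have hpt : ∀ ζ, (A' ζ * ∫⁻ η, V (ζ - η) * M η ∂μ) ^ 2 ≤
      9 * ((∫⁻ η, K₁ ζ η * ((B (ζ - η) * V (ζ - η)) * (D η * M η)) ∂μ) ^ 2 +
        (∫⁻ η, K₂ ζ η * ((B (ζ - η) * V (ζ - η)) * (D η * M η)) ∂μ) ^ 2 +
        (∫⁻ η, K₃ ζ η * ((B (ζ - η) * V (ζ - η)) * (D η * M η)) ∂μ) ^ 2) := by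
    intro ζ
    refine le_trans (pow_le_pow_left' ?_ 2) (add_add_sq_le _ _ _)
    rw [← lintegral_const_mul _ (by fun_prop), ← lintegral_add_left (by fun_prop),
      ← lintegral_add_left (by fun_prop)]
    refine lintegral_mono fun η => ?_
    calc A' ζ * (V (ζ - η) * M η)
        = A' ζ * (((B' (ζ - η) * B (ζ - η)) * V (ζ - η)) * ((D' η * D η) * M η)) := by
          rw [hBB, hDD, one_mul, one_mul]
      _ = (A' ζ * (B' (ζ - η) * D' η)) * ((B (ζ - η) * V (ζ - η)) * (D η * M η)) := by ring
      _ ≤ (K₁ ζ η + K₂ ζ η + K₃ ζ η) * ((B (ζ - η) * V (ζ - η)) * (D η * M η)) := by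
          gcongr; exact hsplit ζ η
      _ = _ := by ring
  refine (lintegral_mono hpt).trans ?_
  rw [lintegral_const_mul _ (by fun_prop), lintegral_add_left (by fun_prop),
    lintegral_add_left (by fun_prop)]
  refine (mul_le_mul' le_rfl (add_le_add (add_le_add h₁ h₂) h₃)).trans (le_of_eq ?_)
  ring

end Bilinear

/-! ### Resonance and the Schrödinger–wave bilinear estimate -/

theorem bracketPow_sq (p r : ℝ) : bracketPow p r ^ 2 = bracketPow (2 * p) r := by
  rw [bracketPow, bracketPow, ← ENNReal.ofReal_pow (Real.rpow_nonneg (bracket_pos r).le _),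
    ← Real.rpow_mul_natCast (bracket_pos r).le, mul_comm, Nat.cast_ofNat]

theorem bracketPow_mul_neg (p r : ℝ) : bracketPow (-p) r * bracketPow p r = 1 := by
  rw [bracketPow, bracketPow, ← ENNReal.ofReal_mul (Real.rpow_nonneg (bracket_pos r).le _),
    ← Real.rpow_add (bracket_pos r)]
  simp

/-- The larger of two brackets may exchange its exponent with the smaller one. -/
theorem bracketPow_mul_swap {a b x y : ℝ} (hab : a ≤ b) (h : bracket x ≤ bracket y) :
    bracketPow (-a) x * bracketPow (-b) y ≤ bracketPow (-b) x * bracketPow (-a) y := by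
  simp only [bracketPow]
  rw [← ENNReal.ofReal_mul (Real.rpow_nonneg (bracket_pos x).le _),
    ← ENNReal.ofReal_mul (Real.rpow_nonneg (bracket_pos x).le _)]
  refine ENNReal.ofReal_le_ofReal ?_
  have hx := bracket_pos x
  have hy := bracket_pos y
  have h1 : bracket x ^ (-a) = bracket x ^ (-b) * bracket x ^ (b - a) := by
    rw [← Real.rpow_add hx]; congr 1; ring
  have h2 : bracket y ^ (-a) = bracket y ^ (-b) * bracket y ^ (b - a) := by
    rw [← Real.rpow_add hy]; congr 1; ring
  rw [h1, h2, mul_assoc, mul_comm (bracket x ^ (b - a))]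
  have := Real.rpow_nonneg hx.le (-b)
  have := Real.rpow_nonneg hy.le (-b)
  gcongr

/-- With A, B, D as set in the proof, B + D - A = ‖ξ‖² + ‖ξ - ξ₁‖² - h(ξ₁), and |h(ξ₁)| ≤ ‖ξ‖ + ‖ξ -
ξ₁‖ is absorbed by half of the squares. The squares are therefore at most 2(⟨A⟩ + ⟨B⟩ + ⟨D⟩) + 2,
hence at most 8 times the largest bracket. The comparisons with ⟨A⟩ in the last two cases serve the
exchange of exponents. -/
theorem resonance_identity_le {d : ℕ} {h : EuclideanSpace ℝ (Fin d) → ℝ} (hh : ∀ ξ, |h ξ| ≤ ‖ξ‖)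
    (ζ η : Spacetime d) :
    ‖ζ.snd‖ ^ 2 + ‖ζ.snd - η.snd‖ ^ 2 ≤ 8 * bracket (ζ.fst - ‖ζ.snd‖ ^ 2) ∨
    ‖ζ.snd‖ ^ 2 + ‖ζ.snd - η.snd‖ ^ 2 ≤ 8 * bracket (ζ.fst - η.fst + ‖ζ.snd - η.snd‖ ^ 2) ∧
      bracket (ζ.fst - ‖ζ.snd‖ ^ 2) ≤ bracket (ζ.fst - η.fst + ‖ζ.snd - η.snd‖ ^ 2) ∨
    ‖ζ.snd‖ ^ 2 + ‖ζ.snd - η.snd‖ ^ 2 ≤ 8 * bracket (η.fst - h η.snd) ∧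
      bracket (ζ.fst - ‖ζ.snd‖ ^ 2) ≤ bracket (η.fst - h η.snd) := by
  set A := ζ.fst - ‖ζ.snd‖ ^ 2 with hA
  set B := ζ.fst - η.fst + ‖ζ.snd - η.snd‖ ^ 2 with hB
  set D := η.fst - h η.snd with hD
  have h1 := abs_le.1 (hh η.snd)
  have h2 : ‖η.snd‖ ≤ ‖ζ.snd‖ + ‖ζ.snd - η.snd‖ := by
    have := norm_sub_le ζ.snd (ζ.snd - η.snd)
    rwa [sub_sub_cancel] at this
  have hA1 := (abs_le.1 (abs_le_bracket A)).1
  have hB1 := (abs_le.1 (abs_le_bracket B)).2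
  have hD1 := (abs_le.1 (abs_le_bracket D)).2
  have hAo := one_le_bracket A
  have key : ‖ζ.snd‖ ^ 2 + ‖ζ.snd - η.snd‖ ^ 2 ≤
      2 * (bracket A + bracket B + bracket D) + 2 := by
    nlinarith [sq_nonneg (‖ζ.snd‖ - 1), sq_nonneg (‖ζ.snd - η.snd‖ - 1)]
  rcases le_total (bracket A) (bracket B) with hab | hab <;>
    rcases le_total (bracket A) (bracket D) with had | had <;>
    rcases le_total (bracket B) (bracket D) with hbd | hbd
  all_goals first
    | exact Or.inl (by linarith)
    | exact Or.inr (Or.inl ⟨by linarith, by linarith⟩)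
    | exact Or.inr (Or.inr ⟨by linarith, by linarith⟩)

/-- The perturbation loses at most r - s, and (r - s)(r + s - 1) ≥ (r² - s²)/2 because r + s ≥ 2. -/
theorem growth_of_lipschitz {E : Type*} [NormedAddCommGroup E] [NormedSpace ℝ E] {k : E → ℝ}
    (hk : ∀ x y, |k x - k y| ≤ ‖x - y‖) {ω : E} (hω : ‖ω‖ = 1) {s r : ℝ} (hs : 1 ≤ s)
    (hsr : s ≤ r) :
    (r ^ 2 - s ^ 2) / 2 ≤ (‖r • ω‖ ^ 2 + k (r • ω)) - (‖s • ω‖ ^ 2 + k (s • ω)) := by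
  have h := (abs_le.1 (hk (r • ω) (s • ω))).1
  rw [← sub_smul, norm_smul, hω, mul_one, Real.norm_eq_abs, abs_of_nonneg (by linarith)] at h
  rw [norm_smul, norm_smul, hω, mul_one, mul_one, Real.norm_eq_abs, Real.norm_eq_abs, sq_abs,
    sq_abs]
  nlinarith

theorem bracketPow_two_mul_cancel {a : ℝ} {x : ℝ} {C : ℝ≥0∞} {T : ℝ≥0∞}
    (h : T ≤ C * ENNReal.ofReal (bracket x ^ (2 * a))) : bracketPow (-(2 * a)) x * T ≤ C := by
  calc _ ≤ bracketPow (-(2 * a)) x * (C * bracketPow (2 * a) x) := by gcongr; exact h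
    _ = C * (bracketPow (-(2 * a)) x * bracketPow (2 * a) x) := by ring
    _ = C := by rw [bracketPow_mul_neg, mul_one]

set_option maxHeartbeats 400000 in
/-- The bilinear estimate behind the commutator bound, for the Schrödinger and wave weights. -/
theorem lintegral_sq_schrodinger_wave_le {d : ℕ} (hd : d ≠ 0) {a b : ℝ} (hb : 1 / 2 < b)
    (hab : a ≤ b) (ha : ((d - 2 : ℕ) : ℝ) ≤ 4 * a) {h : EuclideanSpace ℝ (Fin d) → ℝ}
    (hh : ∀ ξ, |h ξ| ≤ ‖ξ‖) (hlip : ∀ ξ ξ', |h ξ - h ξ'| ≤ ‖ξ - ξ'‖)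
    {V M : Spacetime d → ℝ≥0∞} (hV : Measurable V) (hM : Measurable M) :
    ∫⁻ ζ : Spacetime d, (bracketPow (-a) (ζ.fst - ‖ζ.snd‖ ^ 2) * ∫⁻ η, V (ζ - η) * M η) ^ 2 ≤
      27 * resonanceConst d (2 * b) *
        (∫⁻ ζ : Spacetime d, (bracketPow b (ζ.fst + ‖ζ.snd‖ ^ 2) * V ζ) ^ 2) *
        ∫⁻ η : Spacetime d, (bracketPow b (η.fst - h η.snd) * M η) ^ 2 := by
  have hma := measurable_bracketPow (-a)
  have hmb := measurable_bracketPow (-b)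
  have hmb' := measurable_bracketPow b
  have hm1 := measurable_fst_spacetime (d := d)
  have hm2 := measurable_snd_spacetime (d := d)
  have hhm : Measurable h := by
    have : LipschitzWith 1 h := LipschitzWith.of_dist_le_mul fun x y => by
      simpa [Real.dist_eq, dist_eq_norm] using hlip x y
    exact this.continuous.measurable
  set R : Spacetime d → Spacetime d → ℝ := fun ζ η => ‖ζ.snd‖ ^ 2 + ‖ζ.snd - η.snd‖ ^ 2 with hR
  set A : Spacetime d → ℝ := fun ζ => ζ.fst - ‖ζ.snd‖ ^ 2 with hA
  set B : Spacetime d → ℝ := fun ζ => ζ.fst + ‖ζ.snd‖ ^ 2 with hB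
  set D : Spacetime d → ℝ := fun η => η.fst - h η.snd with hD
  have hAm : Measurable A := by fun_prop
  have hBm : Measurable B := by fun_prop
  have hDm : Measurable D := by fun_prop
  have hRm : Measurable fun x : Spacetime d × Spacetime d => R x.1 x.2 := by fun_prop
  have hbr : Measurable bracket := continuous_bracket.measurable
  -- One kernel for each bracket that can dominate. In every kernel the dominant bracket carries -a
  -- and the other two -b; for K₂ and K₃ this is after the exchange with ⟨A⟩.
  set K₁ : Spacetime d → Spacetime d → ℝ≥0∞ := fun ζ η => {x : Spacetime d × Spacetime d |
    R x.1 x.2 ≤ 8 * bracket (A x.1)}.indicator (fun x => bracketPow (-a) (A x.1) *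
      (bracketPow (-b) (B (x.1 - x.2)) * bracketPow (-b) (D x.2))) (ζ, η) with hK₁
  set K₂ : Spacetime d → Spacetime d → ℝ≥0∞ := fun ζ η => {x : Spacetime d × Spacetime d |
    R x.1 x.2 ≤ 8 * bracket (B (x.1 - x.2))}.indicator (fun x => bracketPow (-a) (B (x.1 - x.2)) *
      (bracketPow (-b) (A x.1) * bracketPow (-b) (D x.2))) (ζ, η) with hK₂
  set K₃ : Spacetime d → Spacetime d → ℝ≥0∞ := fun ζ η => {x : Spacetime d × Spacetime d |
    R x.1 x.2 ≤ 8 * bracket (D x.2)}.indicator (fun x => bracketPow (-a) (D x.2) *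
      (bracketPow (-b) (A x.1) * bracketPow (-b) (B (x.1 - x.2)))) (ζ, η) with hK₃
  have hK₁m : Measurable fun x : Spacetime d × Spacetime d => K₁ x.1 x.2 :=
    Measurable.indicator (by fun_prop) (measurableSet_le hRm (by fun_prop))
  have hK₂m : Measurable fun x : Spacetime d × Spacetime d => K₂ x.1 x.2 :=
    Measurable.indicator (by fun_prop) (measurableSet_le hRm (by fun_prop))
  have hK₃m : Measurable fun x : Spacetime d × Spacetime d => K₃ x.1 x.2 :=
    Measurable.indicator (by fun_prop) (measurableSet_le hRm (by fun_prop))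
  have hsplit : ∀ ζ η, bracketPow (-a) (A ζ) *
      (bracketPow (-b) (B (ζ - η)) * bracketPow (-b) (D η)) ≤ K₁ ζ η + K₂ ζ η + K₃ ζ η := by
    intro ζ η
    have hBeq : B (ζ - η) = ζ.fst - η.fst + ‖ζ.snd - η.snd‖ ^ 2 := rfl
    rcases resonance_identity_le hh ζ η with h1 | ⟨h1, h2⟩ | ⟨h1, h2⟩
    · refine le_trans (le_of_eq ?_) (le_self_add.trans le_self_add)
      simp only [hK₁]
      rw [Set.indicator_of_mem (show (ζ, η) ∈ {x : Spacetime d × Spacetime d |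
        R x.1 x.2 ≤ 8 * bracket (A x.1)} from h1)]
    · refine le_trans ?_ (le_add_self.trans le_self_add)
      simp only [hK₂]
      rw [Set.indicator_of_mem (show (ζ, η) ∈ {x : Spacetime d × Spacetime d |
        R x.1 x.2 ≤ 8 * bracket (B (x.1 - x.2))} from h1)]
      rw [← hBeq] at h2
      have := bracketPow_mul_swap hab h2
      calc _ = (bracketPow (-a) (A ζ) * bracketPow (-b) (B (ζ - η))) * bracketPow (-b) (D η) := by
            ring
        _ ≤ (bracketPow (-b) (A ζ) * bracketPow (-a) (B (ζ - η))) * bracketPow (-b) (D η) := by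
            gcongr
        _ = _ := by ring
    · refine le_trans ?_ le_add_self
      simp only [hK₃]
      rw [Set.indicator_of_mem (show (ζ, η) ∈ {x : Spacetime d × Spacetime d |
        R x.1 x.2 ≤ 8 * bracket (D x.2)} from h1)]
      have := bracketPow_mul_swap hab h2
      calc _ = (bracketPow (-a) (A ζ) * bracketPow (-b) (D η)) * bracketPow (-b) (B (ζ - η)) := by
            ring
        _ ≤ (bracketPow (-b) (A ζ) * bracketPow (-a) (D η)) * bracketPow (-b) (B (ζ - η)) := by
            gcongr
        _ = _ := by ring
  set C := resonanceConst d (2 * b) with hC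
  have hC₁ : ∀ ζ, ∫⁻ η, K₁ ζ η ^ 2 ≤ C := by
    intro ζ
    -- The output is fixed and the integration variable is that of v, reached by η ↦ ζ - η. Then α -
    -- β is ‖ξ‖² plus a 1-Lipschitz function.
    have hres := lintegral_resonance_le hd (p := 2 * b) (by linarith) ha
      (α := fun ξ => ζ.fst - h (ζ.snd - ξ)) (β := fun ξ => -‖ξ‖ ^ 2) (by fun_prop) (by fun_prop)
      0 (by
        intro ω hω s r hs hsr
        have := growth_of_lipschitz (k := fun ξ => ζ.fst - h (ζ.snd - ξ)) (fun x y => by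
          have := hlip (ζ.snd - y) (ζ.snd - x)
          rw [sub_sub_sub_cancel_left] at this
          rwa [sub_sub_sub_cancel_left]) hω hs hsr
        simp only [add_zero]
        linarith) (one_le_bracket (A ζ))
    refine le_trans ?_ (bracketPow_two_mul_cancel hres)
    rw [← lintegral_const_mul _ ?_, ← lintegral_sub_left_eq_self _ ζ]
    · refine lintegral_mono fun η => ?_
      simp only [hK₁]
      by_cases hmem : R ζ (ζ - η) ≤ 8 * bracket (A ζ)
      · rw [Set.indicator_of_mem (by simpa using hmem), Set.indicator_of_mem]
        · simp only [mul_pow, bracketPow_sq, sub_neg_eq_add, mul_neg]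
          refine le_of_eq ?_
          rw [sub_sub_cancel, mul_comm (bracketPow (-(2 * b)) (B η)),
            ← bracketPow_neg_arg _ (D (ζ - η))]
          congr 3
          simp only [hD, WithLp.sub_fst, WithLp.sub_snd]
          ring
        · simp only [hR, WithLp.sub_snd, sub_sub_cancel] at hmem
          simp only [Set.mem_ofPred_eq, sub_zero]
          linarith [sq_nonneg ‖ζ.snd‖]
      · rw [Set.indicator_of_notMem (by simpa using hmem)]
        simp
    · have := measurable_bracketPow (-(2 * b))
      exact Measurable.indicator (by fun_prop) (measurableSet_le (by fun_prop) measurable_const)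
  have hC₂ : ∀ η, ∫⁻ ζ, K₂ ζ (ζ - η) ^ 2 ≤ C := by
    intro η
    -- The variable of v is fixed and the output varies; again α - β is ‖ξ‖² plus a 1-Lipschitz
    -- function.
    have hres := lintegral_resonance_le hd (p := 2 * b) (by linarith) ha
      (α := fun ξ => ‖ξ‖ ^ 2) (β := fun ξ => η.fst + h (ξ - η.snd)) (by fun_prop) (by fun_prop)
      0 (by
        intro ω hω s r hs hsr
        have := growth_of_lipschitz (k := fun ξ => - h (ξ - η.snd)) (fun x y => by
          have := hlip (y - η.snd) (x - η.snd)
          rw [sub_sub_sub_cancel_right, norm_sub_rev] at this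
          rwa [neg_sub_neg]) hω hs hsr
        simp only [add_zero]
        linarith) (one_le_bracket (B η))
    refine le_trans ?_ (bracketPow_two_mul_cancel hres)
    rw [← lintegral_const_mul _ ?_]
    · refine lintegral_mono fun ζ => ?_
      simp only [hK₂]
      by_cases hmem : R ζ (ζ - η) ≤ 8 * bracket (B η)
      · rw [Set.indicator_of_mem (by simpa using hmem), Set.indicator_of_mem]
        · simp only [mul_pow, bracketPow_sq, mul_neg, sub_sub_cancel]
          refine le_of_eq ?_
          congr 3
          simp only [hD, WithLp.sub_fst, WithLp.sub_snd]
          ring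
        · simp only [hR] at hmem
          simp only [Set.mem_ofPred_eq, sub_zero]
          linarith [sq_nonneg ‖ζ.snd - (ζ - η).snd‖]
      · rw [Set.indicator_of_notMem (by simpa using hmem)]
        simp
    · have := measurable_bracketPow (-(2 * b))
      exact Measurable.indicator (by fun_prop) (measurableSet_le (by fun_prop) measurable_const)
  have hC₃ : ∀ η, ∫⁻ ζ, K₃ ζ η ^ 2 ≤ C := by
    intro η
    -- With the wave variable fixed, α - β is ‖ξ‖² + ‖ξ - ξ₁‖² up to a constant. Centring at ξ₁/2
    -- makes it radial by the parallelogram law, and the growth condition is immediate.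
    have hpar : ∀ x : EuclideanSpace ℝ (Fin d), ‖x + (1 / 2 : ℝ) • η.snd‖ ^ 2 +
        ‖x + (1 / 2 : ℝ) • η.snd - η.snd‖ ^ 2 = 2 * ‖x‖ ^ 2 + ‖η.snd‖ ^ 2 / 2 := by
      intro x
      have h1 : x + (1 / 2 : ℝ) • η.snd - η.snd = x - (1 / 2 : ℝ) • η.snd := by module
      have := parallelogram_law_with_norm ℝ x ((1 / 2 : ℝ) • η.snd)
      rw [h1]
      have h2 : ‖(1 / 2 : ℝ) • η.snd‖ = ‖η.snd‖ / 2 := by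
        rw [norm_smul]; norm_num; ring
      rw [h2] at this
      nlinarith
    have hres := lintegral_resonance_le hd (p := 2 * b) (by linarith) ha
      (α := fun ξ => ‖ξ‖ ^ 2) (β := fun ξ => η.fst - ‖ξ - η.snd‖ ^ 2) (by fun_prop) (by fun_prop)
      ((1 / 2 : ℝ) • η.snd) (by
        intro ω hω s r hs hsr
        have h1 := hpar (r • ω)
        have h2 := hpar (s • ω)
        rw [norm_smul r, hω, mul_one, Real.norm_eq_abs, sq_abs] at h1
        rw [norm_smul s, hω, mul_one, Real.norm_eq_abs, sq_abs] at h2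
        nlinarith) (one_le_bracket (D η))
    refine le_trans ?_ (bracketPow_two_mul_cancel hres)
    rw [← lintegral_const_mul _ ?_]
    · refine lintegral_mono fun ζ => ?_
      simp only [hK₃]
      by_cases hmem : R ζ η ≤ 8 * bracket (D η)
      · rw [Set.indicator_of_mem (by simpa using hmem), Set.indicator_of_mem]
        · simp only [mul_pow, bracketPow_sq, mul_neg]
          refine le_of_eq ?_
          congr 3
          simp only [hB, WithLp.sub_fst, WithLp.sub_snd]
          ring
        · have := hpar (ζ.snd - (1 / 2 : ℝ) • η.snd)
          rw [sub_add_cancel] at this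
          simp only [hR] at hmem
          simp only [Set.mem_ofPred_eq]
          nlinarith [sq_nonneg ‖η.snd‖, sq_nonneg ‖ζ.snd - (1 / 2 : ℝ) • η.snd‖]
      · rw [Set.indicator_of_notMem (by simpa using hmem)]
        simp
    · have := measurable_bracketPow (-(2 * b))
      exact Measurable.indicator (by fun_prop) (measurableSet_le (by fun_prop) measurable_const)
  exact lintegral_sq_weighted_le (hmb'.comp hBm) (hmb'.comp hDm)
    (fun ζ => bracketPow_mul_neg b _) (fun ζ => bracketPow_mul_neg b _)
    hK₁m hK₂m hK₃m hsplit hC₁ hC₂ hC₃ hV hM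

/-! ### The convolution theorem for products of L² functions -/

section ConvolutionTheorem

variable {E : Type*} [NormedAddCommGroup E] [InnerProductSpace ℝ E] [FiniteDimensional ℝ E]
  [MeasurableSpace E] [BorelSpace E]

theorem eLpNorm_two_sq {α : Type*} [MeasurableSpace α] {μ : Measure α} (f : α → ℂ) :
    eLpNorm f 2 μ ^ 2 = ∫⁻ x, ‖f x‖ₑ ^ 2 ∂μ := by
  have := eLpNorm_nnreal_pow_eq_lintegral (f := f) (μ := μ) (p := 2) two_ne_zero
  simpa using this

theorem memLp_comp_sub_left {G : E → ℂ} {p : ℝ≥0∞} (hG : MemLp G p) (κ : E) :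
    MemLp (fun ζ => G (κ - ζ)) p :=
  hG.comp_measurePreserving (Measure.measurePreserving_sub_left volume κ)

theorem lintegral_enorm_conv_le {G H : E → ℂ} (hG : AEStronglyMeasurable G)
    (hH : AEStronglyMeasurable H) (κ : E) :
    ∫⁻ ζ, ‖G (κ - ζ) * H ζ‖ₑ ≤ eLpNorm G 2 * eLpNorm H 2 := by
  have hGκ := hG.comp_measurePreserving (Measure.measurePreserving_sub_left volume κ)
  have h := sq_lintegral_mul_le (μ := volume) (f := fun ζ => ‖G (κ - ζ)‖ₑ) (g := fun ζ => ‖H ζ‖ₑ)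
    hGκ.enorm hH.enorm
  rw [lintegral_sub_left_eq_self (fun ζ => ‖G ζ‖ₑ ^ 2) κ, ← eLpNorm_two_sq, ← eLpNorm_two_sq,
    ← mul_pow] at h
  simp_rw [enorm_mul]
  exact (ENNReal.pow_right_strictMono two_ne_zero).le_iff_le.1 h

theorem enorm_integral_conv_le {G H : E → ℂ} (hG : AEStronglyMeasurable G)
    (hH : AEStronglyMeasurable H) (κ : E) :
    ‖∫ ζ, G (κ - ζ) * H ζ‖ₑ ≤ eLpNorm G 2 * eLpNorm H 2 :=
  (enorm_integral_le_lintegral_enorm _).trans (lintegral_enorm_conv_le hG hH κ)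

theorem aestronglyMeasurable_conv_integrand {G H : E → ℂ} (hG : AEStronglyMeasurable G)
    (hH : AEStronglyMeasurable H) :
    AEStronglyMeasurable (fun x : E × E => G (x.1 - x.2) * H x.2)
      ((volume : Measure E).prod volume) := by
  have := hH.convolution_integrand (ContinuousLinearMap.mul ℝ ℂ) hG
  simpa [mul_comm] using this

theorem memLp_top_conv {G H : E → ℂ} (hG : MemLp G 2) (hH : MemLp H 2) :
    MemLp (fun κ => ∫ ζ, G (κ - ζ) * H ζ) ∞ := by
  refine ⟨(aestronglyMeasurable_conv_integrand hG.1 hH.1).integral_prod_right', ?_⟩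
  have hb : ∀ κ, ‖∫ ζ, G (κ - ζ) * H ζ‖ₑ ≤ eLpNorm G 2 * eLpNorm H 2 :=
    enorm_integral_conv_le hG.1 hH.1
  rw [eLpNorm_exponent_top]
  exact (essSup_le_of_ae_le _ (Filter.Eventually.of_forall hb)).trans_lt
    (ENNReal.mul_lt_top hG.2 hH.2)

theorem continuous_integral_mul_Lp {k : E → ℂ} (hk : MemLp k 2) :
    Continuous fun U : Lp ℂ 2 (volume : Measure E) => ∫ z, k z * U z := by
  have : (fun U : Lp ℂ 2 (volume : Measure E) => ∫ z, k z * U z) =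
      fun U => inner ℂ (hk.star.toLp _) U := by
    ext U
    rw [L2.inner_def]
    refine integral_congr_ae ?_
    filter_upwards [hk.star.coeFn_toLp] with z hz
    rw [hz, RCLike.inner_apply]
    simp [mul_comm]
  rw [this]
  fun_prop

theorem integrable_mul_schwartz (φ : 𝓢(E, ℂ)) {u : E → ℂ} {p : ℝ≥0∞} (hp : 1 ≤ p)
    (hu : MemLp u p) : Integrable fun z => φ z * u z := by
  have := ENNReal.HolderConjugate.inv_one_sub_inv' hp
  exact (φ.memLp (1 - p⁻¹)⁻¹).integrable_mul hu

/-- Dominated convergence: for each κ the inner integral is an L² pairing with G, and near G₀ it is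
at most (‖G₀‖ + 1) times the norm of H, uniformly in κ. -/
theorem continuous_integral_mul_conv (φ : 𝓢(E, ℂ)) {H : E → ℂ} (hH : MemLp H 2) :
    Continuous fun G : Lp ℂ 2 (volume : Measure E) => ∫ κ, φ κ * ∫ ζ, G (κ - ζ) * H ζ := by
  rw [continuous_iff_continuousAt]
  intro G₀
  refine continuousAt_of_dominated (bound := fun κ => ‖φ κ‖ * ((‖G₀‖ + 1) * (eLpNorm H 2).toReal))
    ?_ ?_ ?_ ?_
  · refine Filter.Eventually.of_forall fun G => ?_
    exact φ.continuous.aestronglyMeasurable.mul (memLp_top_conv (Lp.memLp G) hH).1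
  · filter_upwards [(continuous_norm.tendsto G₀).eventually_lt_const (lt_add_one ‖G₀‖)] with G hG
    refine Filter.Eventually.of_forall fun κ => ?_
    rw [norm_mul]
    gcongr
    have h := enorm_integral_conv_le (Lp.memLp G).1 hH.1 κ
    have h2 := ENNReal.toReal_mono (ENNReal.mul_lt_top (Lp.memLp G).2 hH.2).ne h
    rw [ENNReal.toReal_mul, toReal_enorm, ← Lp.norm_def] at h2
    refine h2.trans ?_
    gcongr
  · exact φ.integrable.norm.mul_const _
  · refine Filter.Eventually.of_forall fun κ => ?_
    have hc := continuous_integral_mul_Lp (memLp_comp_sub_left hH κ)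
    have heq : ∀ G : Lp ℂ 2 (volume : Measure E), ∫ ζ, G (κ - ζ) * H ζ =
        ∫ ζ, H (κ - ζ) * G ζ := by
      intro G
      rw [← integral_sub_left_eq_self _ volume κ]
      simp [mul_comm]
    simp_rw [heq]
    exact (continuous_const.mul hc).continuousAt

/-- Fubini applies although H is only in L²: Cauchy–Schwarz bounds the ζ-integral uniformly in κ,
and φ is integrable. -/
theorem integral_conv_schwartz_swap (φ g : 𝓢(E, ℂ)) {H : E → ℂ} (hH : MemLp H 2) :
    ∫ ζ, (∫ κ, φ κ * g (κ - ζ)) * H ζ = ∫ κ, φ κ * ∫ ζ, g (κ - ζ) * H ζ := by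
  have hg : MemLp g 2 (volume : Measure E) := g.memLp 2 volume
  have hmeas : AEStronglyMeasurable (fun x : E × E => φ x.1 * (g (x.1 - x.2) * H x.2))
      ((volume : Measure E).prod volume) := by
    refine AEStronglyMeasurable.mul ?_
      (aestronglyMeasurable_conv_integrand g.continuous.aestronglyMeasurable hH.1)
    exact (φ.continuous.comp continuous_fst).aestronglyMeasurable
  have hint : Integrable (fun x : E × E => φ x.1 * (g (x.1 - x.2) * H x.2))
      ((volume : Measure E).prod volume) := by
    refine (integrable_prod_iff hmeas).2 ⟨Filter.Eventually.of_forall fun κ => ?_, ?_⟩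
    · have h : Integrable fun ζ => g (κ - ζ) * H ζ :=
        (memLp_comp_sub_left hg κ).integrable_mul hH
      exact h.const_mul (φ κ)
    · refine Integrable.mono' (φ.integrable.norm.mul_const
        (eLpNorm g 2 volume * eLpNorm H 2 volume).toReal) hmeas.norm.integral_prod_right' ?_
      refine Filter.Eventually.of_forall fun κ => ?_
      rw [Real.norm_of_nonneg (integral_nonneg fun _ => norm_nonneg _)]
      simp_rw [norm_mul (φ κ)]
      rw [integral_const_mul]
      gcongr
      have hm : AEStronglyMeasurable fun ζ => g (κ - ζ) * H ζ :=
        (memLp_comp_sub_left hg κ).1.mul hH.1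
      have hle := lintegral_enorm_conv_le hg.1 hH.1 κ
      rw [integral_norm_eq_lintegral_enorm hm]
      exact ENNReal.toReal_mono (ENNReal.mul_lt_top hg.2 hH.2).ne hle
  have := integral_integral_swap (f := fun κ ζ => φ κ * (g (κ - ζ) * H ζ)) hint
  simp_rw [integral_const_mul] at this
  rw [this]
  refine integral_congr_ae (Filter.Eventually.of_forall fun ζ => ?_)
  simp only [← mul_assoc]
  rw [integral_mul_const]

/-- The Fourier transform takes the product of two square integrable functions to the convolution
of their Fourier transforms. -/
theorem integral_fourier_mul_Lp_mul_Lp (φ : 𝓢(E, ℂ)) (U W : Lp ℂ 2 (volume : Measure E)) :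
    ∫ z, 𝓕 φ z * (U z * W z) =
      ∫ κ, φ κ * ∫ ζ, (𝓕 U : Lp ℂ 2 (volume : Measure E)) (κ - ζ) *
        (𝓕 W : Lp ℂ 2 (volume : Measure E)) ζ := by
  set H : Lp ℂ 2 (volume : Measure E) := 𝓕 W with hHdef
  -- With W fixed, both sides are continuous in G = 𝓕 U, so G may be taken to be a Schwartz
  -- function.
  suffices h : ∀ G : Lp ℂ 2 (volume : Measure E),
      ∫ z, 𝓕 φ z * ((𝓕⁻ G : Lp ℂ 2 (volume : Measure E)) z * W z) =
        ∫ κ, φ κ * ∫ ζ, G (κ - ζ) * H ζ by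
    simpa using h (𝓕 U)
  intro G
  have hk : MemLp (fun z => 𝓕 φ z * W z) 2 :=
    (Lp.memLp W).mul' ((𝓕 φ).memLp ∞)
  refine DenseRange.induction_on (p := fun G : Lp ℂ 2 (volume : Measure E) =>
      ∫ z, 𝓕 φ z * ((𝓕⁻ G : Lp ℂ 2 (volume : Measure E)) z * W z) =
        ∫ κ, φ κ * ∫ ζ, G (κ - ζ) * H ζ)
    (SchwartzMap.denseRange_toLpCLM (p := 2) (μ := (volume : Measure E)) ENNReal.ofNat_ne_top) G
    ?_ ?_
  · refine isClosed_eq ?_ (continuous_integral_mul_conv φ (Lp.memLp H))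
    have h1 := (continuous_integral_mul_Lp hk).comp
      (Lp.fourierTransformₗᵢ E ℂ).symm.continuous
    convert h1 using 2 with G
    refine integral_congr_ae (Filter.Eventually.of_forall fun z => ?_)
    show _ = 𝓕 φ z * W z * (𝓕⁻ G : Lp ℂ 2 (volume : Measure E)) z
    ring
  · intro g
    have e1 : (toLpCLM ℝ ℂ 2 volume g : Lp ℂ 2 (volume : Measure E)) = g.toLp 2 := rfl
    simp only [e1]
    -- The reflection ψ of g satisfies 𝓕 ψ = 𝓕⁻ g. Hence 𝓕 φ · 𝓕⁻ g is the transform of the Schwartz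
    -- function φ ∗ ψ, and duality moves the transform onto W.
    set ψ : 𝓢(E, ℂ) := compCLMOfContinuousLinearEquiv ℂ (ContinuousLinearEquiv.neg ℝ) g with hψ
    have hψa : ∀ x, ψ x = g (-x) := fun x => rfl
    have hF : ∀ z, 𝓕⁻ g z = 𝓕 ψ z := by
      intro z
      rw [fourierInv_coe, fourier_coe, Real.fourierInv_eq_fourier_comp_neg]
      rfl
    set χ : 𝓢(E, ℂ) := SchwartzMap.convolution (ContinuousLinearMap.mul ℂ ℂ) φ ψ with hχ
    have hχF : ∀ z, 𝓕 χ z = 𝓕 φ z * 𝓕 ψ z := by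
      intro z
      rw [hχ, SchwartzMap.fourier_convolution]
      simp
    have hχa : ∀ ζ, χ ζ = ∫ κ, φ κ * g (κ - ζ) := by
      intro ζ
      rw [hχ, SchwartzMap.convolution_apply, convolution_def]
      simp [hψa]
    have hpair : ∫ z, 𝓕 χ z * W z = ∫ ζ, χ ζ * H ζ := by
      have h1 := Lp.fourier_toTemperedDistribution_eq W
      have h2 := congrArg (fun f : 𝓢'(E, ℂ) => f χ) h1
      simpa [TemperedDistribution.fourier_apply] using h2
    calc _ = ∫ z, 𝓕 χ z * W z := by
          rw [toLp_fourierInv_eq]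
          refine integral_congr_ae ?_
          filter_upwards [(𝓕⁻ g).coeFn_toLp 2 volume] with z hz
          rw [hz, hF, hχF]
          ring
      _ = ∫ ζ, (∫ κ, φ κ * g (κ - ζ)) * H ζ := by
          rw [hpair]
          simp_rw [hχa]
      _ = ∫ κ, φ κ * ∫ ζ, g (κ - ζ) * H ζ := integral_conv_schwartz_swap φ g (Lp.memLp H)
      _ = _ := by
          congr 1
          ext κ
          congr 1
          refine integral_congr_ae ?_
          have := (Measure.measurePreserving_sub_left volume κ).quasiMeasurePreserving.ae_eq_comp
            (g.coeFn_toLp 2 volume)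
          filter_upwards [this] with ζ hζ
          simp only [Function.comp_apply] at hζ
          rw [hζ]

end ConvolutionTheorem

/-! ### Functions, Fourier transforms and products of distributions -/

variable {d : ℕ}

theorem two_pi_ne_zero : (2 * Real.pi : ℝ) ≠ 0 := by positivity

/-- Integrability against a smooth bump equal to 1 on a ball is integrability on that ball. -/
theorem IsFunction.locallyIntegrable {f : 𝓢'(Spacetime d, ℂ)} {u : Spacetime d → ℂ}
    (h : IsFunction f u) : LocallyIntegrable u := by
  intro x
  let β : ContDiffBump x := ⟨1, 2, one_pos, one_lt_two⟩
  have hβ₁ : HasCompactSupport (Complex.ofRealCLM ∘ β) := β.hasCompactSupport.comp_left rfl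
  have hβ₂ : ContDiff ℝ (⊤ : ℕ∞) (Complex.ofRealCLM ∘ β) :=
    Complex.ofRealCLM.contDiff.comp β.contDiff
  refine ⟨Metric.closedBall x 1, Metric.closedBall_mem_nhds x one_pos, ?_⟩
  have hint := (h.2 (hβ₁.toSchwartzMap hβ₂)).1.integrableOn (s := Metric.closedBall x 1)
  refine hint.congr_fun (fun z hz => ?_) measurableSet_closedBall
  have : β z = 1 := β.one_of_mem_closedBall hz
  simp [this]

theorem IsFunction.ae_eq {f : 𝓢'(Spacetime d, ℂ)} {u u' : Spacetime d → ℂ}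
    (h : IsFunction f u) (h' : IsFunction f u') : u =ᵐ[volume] u' := by
  refine ae_eq_of_integral_contDiff_smul_eq h.locallyIntegrable h'.locallyIntegrable ?_
  intro g g_smooth g_cpt
  have hg₁ : HasCompactSupport (Complex.ofRealCLM ∘ g) := g_cpt.comp_left rfl
  have hg₂ : ContDiff ℝ (⊤ : ℕ∞) (Complex.ofRealCLM ∘ g) := Complex.ofRealCLM.contDiff.comp g_smooth
  have h1 := (h.2 (hg₁.toSchwartzMap hg₂)).2
  have h2 := (h'.2 (hg₁.toSchwartzMap hg₂)).2
  rw [h1] at h2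
  simpa using h2

theorem IsFunction.congr {f : 𝓢'(Spacetime d, ℂ)} {u u' : Spacetime d → ℂ}
    (h : IsFunction f u) (hu : u =ᵐ[volume] u') : IsFunction f u' := by
  refine ⟨h.1.congr hu, fun φ => ?_⟩
  have hφ : (fun z => φ z * u z) =ᵐ[volume] fun z => φ z * u' z := by
    filter_upwards [hu] with z hz
    rw [hz]
  exact ⟨(h.2 φ).1.congr hφ, (h.2 φ).2.trans (integral_congr_ae hφ)⟩

theorem IsFunction.unique {f f' : 𝓢'(Spacetime d, ℂ)} {u : Spacetime d → ℂ}
    (h : IsFunction f u) (h' : IsFunction f' u) : f = f' := by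
  ext φ
  rw [(h.2 φ).2, (h'.2 φ).2]

theorem IsFunction.sub {f f' : 𝓢'(Spacetime d, ℂ)} {u u' : Spacetime d → ℂ}
    (h : IsFunction f u) (h' : IsFunction f' u') :
    IsFunction (f - f') (fun z => u z - u' z) := by
  refine ⟨h.1.sub h'.1, fun φ => ?_⟩
  have e : (fun z => φ z * (u z - u' z)) = fun z => φ z * u z - φ z * u' z := by
    ext z; ring
  rw [e, integral_sub (h.2 φ).1 (h'.2 φ).1, ← (h.2 φ).2, ← (h'.2 φ).2]
  exact ⟨(h.2 φ).1.sub (h'.2 φ).1, rfl⟩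

theorem isFunction_toTemperedDistribution {p : ℝ≥0∞} [hp : Fact (1 ≤ p)]
    (u : Lp ℂ p (volume : Measure (Spacetime d))) : IsFunction (u : 𝓢'(Spacetime d, ℂ)) u :=
  ⟨(Lp.memLp u).1, fun φ => ⟨integrable_mul_schwartz φ hp.out (Lp.memLp u), by simp⟩⟩

theorem exists_isFunction {p : ℝ≥0∞} (hp : 1 ≤ p) {u : Spacetime d → ℂ} (hu : MemLp u p) :
    ∃ f : 𝓢'(Spacetime d, ℂ), IsFunction f u :=
  have : Fact (1 ≤ p) := ⟨hp⟩
  ⟨_, (isFunction_toTemperedDistribution (hu.toLp u)).congr hu.coeFn_toLp⟩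

theorem memLp_comp_smul {p : ℝ≥0∞} {g : Spacetime d → ℂ} (hg : MemLp g p) {r : ℝ} (hr : r ≠ 0) :
    MemLp (fun ζ => g (r • ζ)) p := by
  have hmap := Measure.map_addHaar_smul (volume : Measure (Spacetime d)) hr
  have h : MemLp g p (Measure.map (fun ζ : Spacetime d => r • ζ) volume) := by
    rw [hmap]
    exact hg.smul_measure ENNReal.ofReal_ne_top
  exact h.comp_of_map (by fun_prop)

theorem HasFourier.ae_eq {f : 𝓢'(Spacetime d, ℂ)} {g g' : Spacetime d → ℂ}
    (h : HasFourier f g) (h' : HasFourier f g') : g =ᵐ[volume] g' := by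
  have := (Measure.quasiMeasurePreserving_smul (volume : Measure (Spacetime d))
    (inv_ne_zero two_pi_ne_zero)).ae_eq_comp (IsFunction.ae_eq h h')
  filter_upwards [this] with ζ hζ
  simpa only [Function.comp_apply, smul_inv_smul₀ two_pi_ne_zero] using hζ

theorem HasFourier.congr {f : 𝓢'(Spacetime d, ℂ)} {g g' : Spacetime d → ℂ}
    (h : HasFourier f g) (hg : g =ᵐ[volume] g') : HasFourier f g' :=
  IsFunction.congr h ((Measure.quasiMeasurePreserving_smul (volume : Measure (Spacetime d))
    two_pi_ne_zero).ae_eq_comp hg)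

theorem HasFourier.aestronglyMeasurable {f : 𝓢'(Spacetime d, ℂ)} {g : Spacetime d → ℂ}
    (h : HasFourier f g) : AEStronglyMeasurable g := by
  have := h.1.comp_quasiMeasurePreserving (Measure.quasiMeasurePreserving_smul
    (volume : Measure (Spacetime d)) (inv_ne_zero two_pi_ne_zero))
  simpa only [Function.comp_def, smul_inv_smul₀ two_pi_ne_zero] using this

theorem HasFourier.unique {f f' : 𝓢'(Spacetime d, ℂ)} {g : Spacetime d → ℂ}
    (h : HasFourier f g) (h' : HasFourier f' g) : f = f' := by
  have := congrArg (fun f : 𝓢'(Spacetime d, ℂ) => 𝓕⁻ f) (IsFunction.unique h h')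
  simpa using this

theorem HasFourier.sub {f f' : 𝓢'(Spacetime d, ℂ)} {g g' : Spacetime d → ℂ}
    (h : HasFourier f g) (h' : HasFourier f' g') :
    HasFourier (f - f') (fun ζ => g ζ - g' ζ) := by
  have := IsFunction.sub h h'
  have e : 𝓕 (f - f') = 𝓕 f - 𝓕 f' := by
    ext φ
    rfl
  rw [HasFourier, e]
  exact this

theorem exists_hasFourier {p : ℝ≥0∞} (hp : 1 ≤ p) {g : Spacetime d → ℂ} (hg : MemLp g p) :
    ∃ f : 𝓢'(Spacetime d, ℂ), HasFourier f g := by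
  obtain ⟨f, hf⟩ := exists_isFunction hp (memLp_comp_smul hg two_pi_ne_zero)
  refine ⟨𝓕⁻ f, ?_⟩
  rwa [HasFourier, FourierTransform.fourier_fourierInv_eq]

/-- A distribution with square integrable Fourier transform is a square integrable function. -/
theorem HasFourier.exists_Lp {f : 𝓢'(Spacetime d, ℂ)} {g : Spacetime d → ℂ}
    (h : HasFourier f g) (hg : MemLp g 2) :
    ∃ U : Lp ℂ 2 (volume : Measure (Spacetime d)), IsFunction f U ∧
      ((𝓕 U : Lp ℂ 2 (volume : Measure (Spacetime d))) : Spacetime d → ℂ) =ᵐ[volume]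
        fun ζ => g ((2 * Real.pi) • ζ) := by
  have hg' := memLp_comp_smul hg two_pi_ne_zero
  set G : Lp ℂ 2 (volume : Measure (Spacetime d)) := hg'.toLp _ with hG
  have h1 : IsFunction (G : 𝓢'(Spacetime d, ℂ)) fun ζ => g ((2 * Real.pi) • ζ) :=
    (isFunction_toTemperedDistribution G).congr hg'.coeFn_toLp
  have h2 : 𝓕 f = (G : 𝓢'(Spacetime d, ℂ)) := IsFunction.unique h h1
  refine ⟨𝓕⁻ G, ?_, ?_⟩
  · have h3 : f = ((𝓕⁻ G : Lp ℂ 2 (volume : Measure (Spacetime d))) : 𝓢'(Spacetime d, ℂ)) := by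
      rw [← Lp.fourierInv_toTemperedDistribution_eq, ← h2]
      simp
    rw [h3]
    exact isFunction_toTemperedDistribution _
  · rw [FourierTransform.fourier_fourierInv_eq]
    exact hg'.coeFn_toLp

/-- The constant `(2π)^{-(1+d)}` in the convolution theorem. -/
noncomputable def fourierConst (d : ℕ) : ℝ :=
  |((2 * Real.pi) ^ Module.finrank ℝ (Spacetime d))⁻¹|

theorem fourierConst_pos (d : ℕ) : 0 < fourierConst d := by
  unfold fourierConst
  have := Real.pi_pos
  positivity

/-- The product of two distributions with square integrable Fourier transforms exists, and its
Fourier transform is the convolution. -/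
theorem exists_isProduct {f f' : 𝓢'(Spacetime d, ℂ)} {g g' : Spacetime d → ℂ}
    (h : HasFourier f g) (hg : MemLp g 2) (h' : HasFourier f' g') (hg' : MemLp g' 2) :
    ∃ p : 𝓢'(Spacetime d, ℂ), IsProduct f f' p ∧
      HasFourier p fun ζ => (fourierConst d : ℂ) * ∫ η, g (ζ - η) * g' η := by
  obtain ⟨U, hU, hUg⟩ := h.exists_Lp hg
  obtain ⟨W, hW, hWg⟩ := h'.exists_Lp hg'
  have hUW : MemLp (fun z => U z * W z) 1 := (Lp.memLp W).mul' (Lp.memLp U)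
  obtain ⟨p, hp⟩ := exists_isFunction le_rfl hUW
  refine ⟨p, ⟨U, W, hU, hW, hp⟩, ?_⟩
  have hgs := memLp_comp_smul hg two_pi_ne_zero
  have hgs' := memLp_comp_smul hg' two_pi_ne_zero
  -- Rescaling the convolution variable by 2π passes between the two normalisations; its Jacobian is
  -- `fourierConst`.
  have hconv : ∀ κ : Spacetime d, (fourierConst d : ℂ) * ∫ η, g ((2 * Real.pi) • κ - η) * g' η =
      ∫ ζ, (𝓕 U : Lp ℂ 2 (volume : Measure (Spacetime d))) (κ - ζ) *
        (𝓕 W : Lp ℂ 2 (volume : Measure (Spacetime d))) ζ := by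
    intro κ
    have h1 := Measure.integral_comp_smul (volume : Measure (Spacetime d))
      (fun η => g ((2 * Real.pi) • κ - η) * g' η) (2 * Real.pi)
    rw [Complex.real_smul] at h1
    rw [fourierConst, ← h1]
    refine integral_congr_ae ?_
    have h2 := (Measure.measurePreserving_sub_left (volume : Measure (Spacetime d))
      κ).quasiMeasurePreserving.ae_eq_comp hUg
    filter_upwards [h2, hWg] with ζ h3 h4
    simp only [Function.comp_apply] at h3
    rw [h3, h4, smul_sub]
  have hbdd := memLp_top_conv (Lp.memLp (𝓕 U : Lp ℂ 2 (volume : Measure (Spacetime d))))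
    (Lp.memLp (𝓕 W : Lp ℂ 2 (volume : Measure (Spacetime d))))
  unfold HasFourier
  simp only [hconv]
  refine ⟨hbdd.1, fun φ => ⟨integrable_mul_schwartz φ le_top hbdd, ?_⟩⟩
  rw [TemperedDistribution.fourier_apply, (hp.2 _).2]
  exact integral_fourier_mul_Lp_mul_Lp φ U W

theorem IsProduct.unique {f f' p p' : 𝓢'(Spacetime d, ℂ)} (h : IsProduct f f' p)
    (h' : IsProduct f f' p') : p = p' := by
  obtain ⟨u, w, hu, hw, hp⟩ := h
  obtain ⟨u', w', hu', hw', hp'⟩ := h'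
  refine hp.unique (hp'.congr ?_)
  filter_upwards [hu.ae_eq hu', hw.ae_eq hw'] with z h1 h2
  rw [h1, h2]

theorem IsMultiplier.hasFourier {a : EuclideanSpace ℝ (Fin d) → ℝ} {f f' : 𝓢'(Spacetime d, ℂ)}
    (h : IsMultiplier a f f') {g : Spacetime d → ℂ} (hg : HasFourier f g) :
    HasFourier f' fun ζ => (a ζ.snd : ℂ) * g ζ := by
  obtain ⟨g', h1, h2⟩ := h
  refine h2.congr ?_
  filter_upwards [h1.ae_eq hg] with ζ hζ
  rw [hζ]

theorem IsMultiplier.unique {a : EuclideanSpace ℝ (Fin d) → ℝ} {f f' f'' : 𝓢'(Spacetime d, ℂ)}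
    (h : IsMultiplier a f f') (h' : IsMultiplier a f f'') : f' = f'' := by
  obtain ⟨g, h1, h2⟩ := h
  exact h2.unique (h'.hasFourier h1)

theorem IsCommutator.unique {σ : ℝ} {v m F F' : 𝓢'(Spacetime d, ℂ)} (h : IsCommutator σ v m F)
    (h' : IsCommutator σ v m F') : F = F' := by
  obtain ⟨p, w, q, r, hp, hw, hq, hr, rfl⟩ := h
  obtain ⟨p', w', q', r', hp', hw', hq', hr', rfl⟩ := h'
  obtain rfl := hp.unique hp'
  obtain rfl := IsMultiplier.unique hw hw'
  obtain rfl := hq.unique hq'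
  obtain rfl := IsMultiplier.unique hr hr'
  rfl

/-! ### The norms and complex conjugation -/

theorem bourgainNorm_eq {h : EuclideanSpace ℝ (Fin d) → ℝ} {s b : ℝ} {f : 𝓢'(Spacetime d, ℂ)}
    {g : Spacetime d → ℂ} (hg : HasFourier f g) :
    bourgainNorm h s b f = eLpNorm (fun ζ : Spacetime d =>
      ((bracket ‖ζ.snd‖ ^ s * bracket (ζ.fst - h ζ.snd) ^ b : ℝ) : ℂ) * g ζ) 2 volume := by
  refine le_antisymm (iInf₂_le g hg) (le_iInf₂ fun g' hg' => le_of_eq (eLpNorm_congr_ae ?_))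
  filter_upwards [hg.ae_eq hg'] with ζ hζ
  rw [hζ]

theorem exists_hasFourier_of_bourgainNorm_lt_top {h : EuclideanSpace ℝ (Fin d) → ℝ} {s b : ℝ}
    {f : 𝓢'(Spacetime d, ℂ)} (hf : bourgainNorm h s b f < ∞) : ∃ g, HasFourier f g := by
  by_contra! hc
  simp [bourgainNorm, hc] at hf

theorem gevreyBourgainNorm_eq {h : EuclideanSpace ℝ (Fin d) → ℝ} {σ s b : ℝ}
    {f f' : 𝓢'(Spacetime d, ℂ)} (hf : IsExpD σ f f') :
    gevreyBourgainNorm h σ s b f = bourgainNorm h s b f' := by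
  refine le_antisymm (iInf₂_le f' hf) (le_iInf₂ fun f'' hf'' => ?_)
  rw [IsMultiplier.unique hf hf'']

theorem exists_isExpD_of_gevreyBourgainNorm_lt_top {h : EuclideanSpace ℝ (Fin d) → ℝ} {σ s b : ℝ}
    {f : 𝓢'(Spacetime d, ℂ)} (hf : gevreyBourgainNorm h σ s b f < ∞) : ∃ f', IsExpD σ f f' := by
  by_contra! hc
  simp [gevreyBourgainNorm, hc] at hf

/-- The Fourier transform of the complex conjugate. -/
theorem HasFourier.conj {f : 𝓢'(Spacetime d, ℂ)} {g : Spacetime d → ℂ} (h : HasFourier f g) :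
    HasFourier (conjDistribution f) fun ζ => conj (g (-ζ)) := by
  have hmeas : AEStronglyMeasurable (fun ζ : Spacetime d => conj (g ((2 * Real.pi) • -ζ))) := by
    have h1 := h.1.comp_measurePreserving (Measure.measurePreserving_neg volume)
    exact Complex.continuous_conj.comp_aestronglyMeasurable h1
  have e : (fun ζ : Spacetime d => conj (g (-((2 * Real.pi) • ζ)))) =
      fun ζ : Spacetime d => conj (g ((2 * Real.pi) • -ζ)) := by
    ext ζ; rw [smul_neg]
  rw [HasFourier, e]
  refine ⟨hmeas, fun φ => ?_⟩
  -- Conjugating a transform reflects the argument, so ψ is chosen with conj (𝓕 φ) = 𝓕 ψ.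
  set ψ : 𝓢(Spacetime d, ℂ) :=
    compCLMOfContinuousLinearEquiv ℂ (ContinuousLinearEquiv.neg ℝ) (conjSchwartz φ) with hψ
  have hψa : ∀ ζ, ψ ζ = conj (φ (-ζ)) := fun ζ => rfl
  have hF : conjSchwartz (𝓕 φ) = 𝓕 ψ := by
    ext z
    show conj (𝓕 φ z) = 𝓕 ψ z
    rw [fourier_coe, fourier_coe, Real.fourier_eq, Real.fourier_eq, ← integral_conj,
      ← integral_neg_eq_self]
    refine integral_congr_ae (Filter.Eventually.of_forall fun x => ?_)
    simp only [hψa, Circle.smul_def, smul_eq_mul, map_mul, inner_neg_left, neg_neg,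
      Real.fourierChar_apply, ← Complex.exp_conj, Complex.conj_I, Complex.conj_ofReal]
    congr 2
    push_cast
    ring
  obtain ⟨hint, heq⟩ := h.2 ψ
  have hpt : ∀ ζ : Spacetime d, φ ζ * conj (g ((2 * Real.pi) • -ζ)) =
      conj (ψ (-ζ) * g ((2 * Real.pi) • -ζ)) := by
    intro ζ
    simp [hψa]
  simp only [hpt]
  refine ⟨?_, ?_⟩
  · exact Complex.conjCLE.toContinuousLinearMap.integrable_comp hint.comp_neg
  · rw [integral_conj, integral_neg_eq_self (fun ζ => ψ ζ * g ((2 * Real.pi) • ζ)), ← heq,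
      TemperedDistribution.fourier_apply, TemperedDistribution.fourier_apply, ← hF]
    rfl

/-! ### The commutator on the Fourier side -/

theorem l1norm_nonneg (ξ : EuclideanSpace ℝ (Fin d)) : 0 ≤ l1norm ξ :=
  Finset.sum_nonneg fun _ _ => abs_nonneg _

theorem l1norm_add_le (ξ η : EuclideanSpace ℝ (Fin d)) :
    l1norm (ξ + η) ≤ l1norm ξ + l1norm η := by
  simp only [l1norm, ← Finset.sum_add_distrib]
  exact Finset.sum_le_sum fun i _ => abs_add_le _ _

theorem l1norm_neg (ξ : EuclideanSpace ℝ (Fin d)) : l1norm (-ξ) = l1norm ξ := by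
  simp [l1norm]

theorem abs_l1norm_sub_le (ξ η : EuclideanSpace ℝ (Fin d)) :
    |l1norm ξ - l1norm (ξ - η)| ≤ l1norm η := by
  have h1 := l1norm_add_le (ξ - η) η
  have h2 := l1norm_add_le ξ (-η)
  rw [sub_add_cancel] at h1
  rw [l1norm_neg, ← sub_eq_add_neg] at h2
  exact abs_le.2 ⟨by linarith, by linarith⟩

theorem l1norm_le_mul_bracket (ξ : EuclideanSpace ℝ (Fin d)) :
    l1norm ξ ≤ d * bracket ‖ξ‖ := by
  calc l1norm ξ ≤ ∑ _i : Fin d, bracket ‖ξ‖ := Finset.sum_le_sum fun i _ => by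
        refine le_trans ?_ (abs_le_bracket _)
        rw [abs_norm]
        exact PiLp.norm_apply_le ξ i
    _ = _ := by simp

theorem continuous_l1norm : Continuous (l1norm (d := d)) := by unfold l1norm; fun_prop

/-- With L = σ `l1norm ξ₁`, the factor L supplies the power of σ and one derivative on m, and e^L is
the Gevrey weight of m. -/
theorem abs_one_sub_exp_le {y L : ℝ} (h : |y| ≤ L) : |1 - Real.exp y| ≤ L * Real.exp L := by
  have hL := (abs_nonneg y).trans h
  have h1 := Real.add_one_le_exp y
  have h2 := Real.add_one_le_exp (-y)
  have h3 := Real.exp_le_exp.2 ((le_abs_self y).trans h)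
  have h4 := Real.one_le_exp hL
  have h5 := abs_le.1 h
  have h6 : Real.exp y * Real.exp (-y) = 1 := by rw [← Real.exp_add]; simp
  have h7 := Real.exp_pos y
  refine abs_le.2 ⟨?_, ?_⟩
  · have : Real.exp y - 1 ≤ y * Real.exp y := by nlinarith
    rcases le_total 0 y with hy | hy
    · have : y * Real.exp y ≤ L * Real.exp L := by
        apply mul_le_mul h5.2 h3 h7.le hL
      linarith
    · have : Real.exp y ≤ 1 := Real.exp_le_one_iff.2 hy
      nlinarith [Real.exp_pos L]
  · nlinarith

theorem sq_eLpNorm_ofReal_mul {w : Spacetime d → ℝ} (hw : ∀ ζ, 0 ≤ w ζ) (g : Spacetime d → ℂ) :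
    eLpNorm (fun ζ => (w ζ : ℂ) * g ζ) 2 volume ^ 2 =
      ∫⁻ ζ, (ENNReal.ofReal (w ζ) * ‖g ζ‖ₑ) ^ 2 := by
  rw [eLpNorm_two_sq]
  refine lintegral_congr fun ζ => ?_
  rw [enorm_mul, ← ofReal_norm (w ζ : ℂ), Complex.norm_real, Real.norm_of_nonneg (hw ζ)]

theorem memLp_of_weight_mul {w : Spacetime d → ℝ} (hw : ∀ ζ, 1 ≤ w ζ) {g : Spacetime d → ℂ}
    (hg : AEStronglyMeasurable g) (h : eLpNorm (fun ζ => (w ζ : ℂ) * g ζ) 2 volume < ∞) :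
    MemLp g 2 := by
  refine ⟨hg, lt_of_le_of_lt (eLpNorm_mono fun ζ => ?_) h⟩
  rw [norm_mul, Complex.norm_real, Real.norm_of_nonneg (zero_le_one.trans (hw ζ))]
  exact le_mul_of_one_le_left (norm_nonneg _) (hw ζ)

theorem HasFourier.exists_stronglyMeasurable {f : 𝓢'(Spacetime d, ℂ)} {g : Spacetime d → ℂ}
    (h : HasFourier f g) : ∃ g', StronglyMeasurable g' ∧ HasFourier f g' :=
  ⟨_, h.aestronglyMeasurable.stronglyMeasurable_mk, h.congr h.aestronglyMeasurable.ae_eq_mk⟩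

theorem aestronglyMeasurable_exp_mul {g : Spacetime d → ℂ} (hg : AEStronglyMeasurable g) (σ : ℝ) :
    AEStronglyMeasurable fun ζ : Spacetime d => (Real.exp (σ * l1norm ζ.snd) : ℂ) * g ζ := by
  refine AEStronglyMeasurable.mul ?_ hg
  have := continuous_l1norm.measurable.comp (measurable_snd_spacetime (d := d))
  exact (Complex.measurable_ofReal.comp
    (Real.measurable_exp.comp (this.const_mul σ))).aestronglyMeasurable

/-- The commutator is defined, and its Fourier transform is bounded by `σ` times a convolution. -/
theorem exists_isCommutator {σ : ℝ} (hσ : 0 ≤ σ) {v m : 𝓢'(Spacetime d, ℂ)}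
    {g k : Spacetime d → ℂ} (hg : HasFourier v g) (hg2 : MemLp g 2) (hk : HasFourier m k)
    (hk2 : MemLp (fun ζ : Spacetime d => (Real.exp (σ * l1norm ζ.snd) : ℂ) * k ζ) 2) :
    ∃ (F : 𝓢'(Spacetime d, ℂ)) (G : Spacetime d → ℂ), IsCommutator σ v m F ∧ HasFourier F G ∧
      ∀ ζ, ‖G ζ‖ₑ ≤ ENNReal.ofReal (fourierConst d * (σ * d)) * ∫⁻ η : Spacetime d, ‖g (ζ - η)‖ₑ *
        (ENNReal.ofReal (bracket ‖η.snd‖) * (ENNReal.ofReal (Real.exp (σ * l1norm η.snd)) *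
          ‖k η‖ₑ)) := by
  have hk0 : MemLp k 2 := by
    refine memLp_of_weight_mul (w := fun ζ => Real.exp (σ * l1norm ζ.snd)) (fun ζ => ?_)
      hk.aestronglyMeasurable hk2.2
    exact Real.one_le_exp (mul_nonneg hσ (l1norm_nonneg _))
  have hw2 : MemLp (fun ζ : Spacetime d => (Real.exp (-σ * l1norm ζ.snd) : ℂ) * g ζ) 2 := by
    refine hg2.mono (aestronglyMeasurable_exp_mul hg2.1 (-σ)) (Filter.Eventually.of_forall
      fun ζ => ?_)
    rw [norm_mul, Complex.norm_real, Real.norm_of_nonneg (Real.exp_pos _).le]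
    refine mul_le_of_le_one_left (norm_nonneg _) (Real.exp_le_one_iff.2 ?_)
    nlinarith [l1norm_nonneg ζ.snd]
  obtain ⟨p, hp, hpF⟩ := exists_isProduct hg hg2 hk hk0
  obtain ⟨w, hw⟩ := exists_hasFourier one_le_two hw2
  obtain ⟨q, hq, hqF⟩ := exists_isProduct hk hk0 hw hw2
  set E : EuclideanSpace ℝ (Fin d) → EuclideanSpace ℝ (Fin d) → ℝ := fun ξ η =>
    Real.exp (σ * (l1norm ξ - l1norm (ξ - η))) with hE
  have hEk : ∀ ξ η, E ξ η ≤ Real.exp (σ * l1norm η) := fun ξ η =>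
    Real.exp_le_exp.2 (mul_le_mul_of_nonneg_left
      ((le_abs_self _).trans (abs_l1norm_sub_le ξ η)) hσ)
  have hEm : ∀ ξ, Measurable (E ξ) := by
    intro ξ
    have := (continuous_l1norm (d := d)).measurable
    fun_prop
  have hR : ∀ ζ : Spacetime d, (Real.exp (σ * l1norm ζ.snd) : ℂ) * ((fourierConst d : ℂ) *
      ∫ η, k (ζ - η) * ((Real.exp (-σ * l1norm η.snd) : ℂ) * g η)) =
      (fourierConst d : ℂ) * ∫ η, (E ζ.snd η.snd : ℂ) * (g (ζ - η) * k η) := by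
    intro ζ
    rw [mul_left_comm, ← integral_const_mul, ← integral_sub_left_eq_self _ volume ζ]
    congr 2
    ext η
    rw [sub_sub_cancel]
    have : E ζ.snd η.snd = Real.exp (σ * l1norm ζ.snd) * Real.exp (-σ * l1norm (ζ - η).snd) := by
      simp only [hE, WithLp.sub_snd, ← Real.exp_add]
      congr 1
      ring
    rw [this]
    push_cast
    ring
  have hnorm : ∀ ζ η : Spacetime d, ‖(E ζ.snd η.snd : ℂ) * (g (ζ - η) * k η)‖ ≤
      ‖g (ζ - η) * ((Real.exp (σ * l1norm η.snd) : ℂ) * k η)‖ := by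
    intro ζ η
    rw [norm_mul, norm_mul, norm_mul, norm_mul, Complex.norm_real, Complex.norm_real,
      Real.norm_of_nonneg (Real.exp_pos _).le, Real.norm_of_nonneg (Real.exp_pos _).le,
      mul_left_comm]
    gcongr
    exact (le_abs_self _).trans (abs_l1norm_sub_le _ _)
  -- The exponential is unbounded, so e^{σ‖D‖} q need not exist for a general q. Here the combined
  -- factor E is at most e^{σ `l1norm η`}, which m absorbs, and the transform is a bounded function.
  have hr2 : MemLp (fun ζ : Spacetime d => (Real.exp (σ * l1norm ζ.snd) : ℂ) *
      ((fourierConst d : ℂ) * ∫ η, k (ζ - η) * ((Real.exp (-σ * l1norm η.snd) : ℂ) * g η))) ∞ := by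
    have hm := aestronglyMeasurable_exp_mul hqF.aestronglyMeasurable σ
    refine ⟨hm, ?_⟩
    rw [eLpNorm_exponent_top]
    have hfin := ENNReal.mul_lt_top (ENNReal.ofReal_lt_top (r := fourierConst d))
      (ENNReal.mul_lt_top hg2.2 hk2.2)
    refine (essSup_le_of_ae_le _ (Filter.Eventually.of_forall fun ζ => ?_)).trans_lt hfin
    simp only [hR]
    rw [enorm_mul, ← ofReal_norm (fourierConst d : ℂ), Complex.norm_real,
      Real.norm_of_nonneg (fourierConst_pos d).le]
    gcongr
    refine (enorm_integral_le_lintegral_enorm _).trans ?_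
    refine (lintegral_mono fun η => ?_).trans (lintegral_enorm_conv_le hg2.1 hk2.1 ζ)
    exact enorm_le_iff_norm_le.2 (hnorm ζ η)
  obtain ⟨r, hr⟩ := exists_hasFourier le_top hr2
  refine ⟨p - r, _, ⟨p, w, q, r, hp, ⟨g, hg, hw⟩, hq, ⟨_, hqF, hr⟩, rfl⟩, hpF.sub hr, fun ζ => ?_⟩
  have hi1 : Integrable fun η => g (ζ - η) * k η := (memLp_comp_sub_left hg2 ζ).integrable_mul hk0
  have hi3 : Integrable fun η : Spacetime d =>
      g (ζ - η) * ((Real.exp (σ * l1norm η.snd) : ℂ) * k η) :=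
    (memLp_comp_sub_left hg2 ζ).integrable_mul hk2
  have hi2 : Integrable fun η : Spacetime d => (E ζ.snd η.snd : ℂ) * (g (ζ - η) * k η) := by
    refine hi3.mono (AEStronglyMeasurable.mul ?_ hi1.1) (Filter.Eventually.of_forall (hnorm ζ))
    exact (Complex.measurable_ofReal.comp
      ((hEm ζ.snd).comp measurable_snd_spacetime)).aestronglyMeasurable
  rw [hR, ← mul_sub, ← integral_sub hi1 hi2, enorm_mul, ← ofReal_norm (fourierConst d : ℂ),
    Complex.norm_real, Real.norm_of_nonneg (fourierConst_pos d).le,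
    ENNReal.ofReal_mul (fourierConst_pos d).le, mul_assoc]
  gcongr
  refine (enorm_integral_le_lintegral_enorm _).trans ?_
  rw [← lintegral_const_mul' _ _ ENNReal.ofReal_ne_top]
  refine lintegral_mono fun η => ?_
  have hfac : g (ζ - η) * k η - (E ζ.snd η.snd : ℂ) * (g (ζ - η) * k η) =
      ((1 - E ζ.snd η.snd : ℝ) : ℂ) * (g (ζ - η) * k η) := by
    push_cast; ring
  rw [hfac, enorm_mul, enorm_mul, ← ofReal_norm ((1 - E ζ.snd η.snd : ℝ) : ℂ),
    Complex.norm_real, Real.norm_eq_abs]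
  have hle : |1 - E ζ.snd η.snd| ≤
      σ * d * (bracket ‖η.snd‖ * Real.exp (σ * l1norm η.snd)) := by
    have h1 : |σ * (l1norm ζ.snd - l1norm (ζ.snd - η.snd))| ≤ σ * l1norm η.snd := by
      rw [abs_mul, abs_of_nonneg hσ]
      exact mul_le_mul_of_nonneg_left (abs_l1norm_sub_le _ _) hσ
    refine (abs_one_sub_exp_le h1).trans ?_
    calc σ * l1norm η.snd * Real.exp (σ * l1norm η.snd)
        ≤ σ * (d * bracket ‖η.snd‖) * Real.exp (σ * l1norm η.snd) := by
          gcongr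
          exact l1norm_le_mul_bracket _
      _ = _ := by ring
  calc _ ≤ ENNReal.ofReal (σ * d * (bracket ‖η.snd‖ * Real.exp (σ * l1norm η.snd))) *
        (‖g (ζ - η)‖ₑ * ‖k η‖ₑ) := by gcongr
    _ = _ := by
      rw [ENNReal.ofReal_mul (by positivity), ENNReal.ofReal_mul (bracket_pos _).le]
      ring

/-! ### The commutator estimate -/

theorem abs_hWave_le (pm : PM) (ξ : EuclideanSpace ℝ (Fin d)) : |hWave pm ξ| ≤ ‖ξ‖ := by
  cases pm <;> simp [hWave]

theorem abs_hWave_sub_le (pm : PM) (ξ ξ' : EuclideanSpace ℝ (Fin d)) :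
    |hWave pm ξ - hWave pm ξ'| ≤ ‖ξ - ξ'‖ := by
  cases pm
  · rw [hWave, hWave, neg_sub_neg, norm_sub_rev]
    exact abs_norm_sub_norm_le _ _
  · exact abs_norm_sub_norm_le _ _

theorem one_le_bracket_rpow {s : ℝ} (hs : 0 ≤ s) (r : ℝ) : 1 ≤ bracket r ^ s :=
  Real.one_le_rpow (one_le_bracket r) hs

theorem sq_bourgainNorm {h : EuclideanSpace ℝ (Fin d) → ℝ} {s b : ℝ} {f : 𝓢'(Spacetime d, ℂ)}
    {g : Spacetime d → ℂ} (hg : HasFourier f g) :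
    bourgainNorm h s b f ^ 2 = ∫⁻ ζ : Spacetime d, (bracketPow s ‖ζ.snd‖ *
      bracketPow b (ζ.fst - h ζ.snd) * ‖g ζ‖ₑ) ^ 2 := by
  have hnn : ∀ r p : ℝ, 0 ≤ bracket r ^ p := fun r p => Real.rpow_nonneg (bracket_pos r).le p
  rw [bourgainNorm_eq hg, sq_eLpNorm_ofReal_mul fun ζ => mul_nonneg (hnn _ _) (hnn _ _)]
  simp_rw [ENNReal.ofReal_mul (hnn _ _), bracketPow]

theorem memLp_of_bourgainNorm_lt_top {h : EuclideanSpace ℝ (Fin d) → ℝ} {s b : ℝ} (hs : 0 ≤ s)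
    (hb : 0 ≤ b) {f : 𝓢'(Spacetime d, ℂ)} (hf : bourgainNorm h s b f < ∞) {g : Spacetime d → ℂ}
    (hg : HasFourier f g) : MemLp g 2 := by
  rw [bourgainNorm_eq hg] at hf
  refine memLp_of_weight_mul (fun ζ => ?_) hg.aestronglyMeasurable hf
  exact one_le_mul_of_one_le_of_one_le (one_le_bracket_rpow hs _) (one_le_bracket_rpow hb _)

/-- The norm of the conjugate of a distribution in a Bourgain space of the Schrödinger phase. -/
theorem sq_bourgainNorm_conj {b : ℝ} {f : 𝓢'(Spacetime d, ℂ)} {g : Spacetime d → ℂ}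
    (hg : HasFourier f g) :
    bourgainNorm hSchr 0 b (conjDistribution f) ^ 2 =
      ∫⁻ ζ : Spacetime d, (bracketPow b (ζ.fst - ‖ζ.snd‖ ^ 2) * ‖g ζ‖ₑ) ^ 2 := by
  rw [sq_bourgainNorm hg.conj, ← lintegral_neg_eq_self]
  refine lintegral_congr fun ζ => ?_
  have h0 : ∀ r, bracketPow 0 r = 1 := fun r => by simp [bracketPow]
  rw [h0, one_mul, neg_neg, ← bracketPow_neg_arg]
  congr 2
  · congr 1
    simp [hSchr]
    ring
  · rw [← ofReal_norm, ← ofReal_norm, RCLike.norm_conj]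

theorem exists_commutator_estimate (hd : d ≠ 0) {b b' : ℝ} (hb : 1 / 2 < b) (hbb' : b ≤ b')
    (hd' : ((d - 2 : ℕ) : ℝ) ≤ 4 * (1 - b')) :
    ∃ C : ℝ, 0 < C ∧ ∀ σ : ℝ, 0 ≤ σ → ∀ (pm : PM) (v m : 𝓢'(Spacetime d, ℂ)),
      bourgainNorm hSchr 0 b v < ∞ → gevreyBourgainNorm (hWave pm) σ 1 b m < ∞ →
        ∃ F : 𝓢'(Spacetime d, ℂ), IsCommutator σ v m F ∧
          bourgainNorm hSchr 0 (b' - 1) (conjDistribution F) ≤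
            ENNReal.ofReal (C * σ) * bourgainNorm hSchr 0 b v *
              gevreyBourgainNorm (hWave pm) σ 1 b m := by
  set R : ℝ := (27 * resonanceConst d (2 * b)).toReal with hR
  have hRtop : 27 * resonanceConst d (2 * b) ≠ ∞ :=
    (ENNReal.mul_lt_top (by simp) (resonanceConst_lt_top d (by linarith))).ne
  have hRnn : 0 ≤ R := ENNReal.toReal_nonneg
  have hc := fourierConst_pos d
  have hdpos : (0 : ℝ) < d := by exact_mod_cast Nat.pos_of_ne_zero hd
  -- The factor d comes from `l1norm ξ` ≤ d ⟨ξ⟩, and √R + 1 replaces √R so that positivity is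
  -- evident.
  refine ⟨fourierConst d * d * (√R + 1), by positivity, ?_⟩
  intro σ hσ pm v m hv hm
  obtain ⟨g₀, hg₀⟩ := exists_hasFourier_of_bourgainNorm_lt_top hv
  obtain ⟨g, hgm, hg⟩ := hg₀.exists_stronglyMeasurable
  obtain ⟨m', hmm'⟩ := exists_isExpD_of_gevreyBourgainNorm_lt_top hm
  obtain ⟨k₀, hk₀, -⟩ := id hmm'
  obtain ⟨k, hkm, hk⟩ := hk₀.exists_stronglyMeasurable
  have hk' := IsMultiplier.hasFourier hmm' hk
  rw [gevreyBourgainNorm_eq hmm'] at hm ⊢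
  have hg2 := memLp_of_bourgainNorm_lt_top le_rfl (by linarith) hv hg
  have hk2 := memLp_of_bourgainNorm_lt_top zero_le_one (by linarith) hm hk'
  obtain ⟨F, G, hF, hG, hbound⟩ := exists_isCommutator hσ hg hg2 hk hk2
  refine ⟨F, hF, ?_⟩
  set V : Spacetime d → ℝ≥0∞ := fun ζ => ‖g ζ‖ₑ with hV
  set M : Spacetime d → ℝ≥0∞ := fun η => ENNReal.ofReal (bracket ‖η.snd‖) *
    (ENNReal.ofReal (Real.exp (σ * l1norm η.snd)) * ‖k η‖ₑ) with hM
  have hVm : Measurable V := hgm.measurable.enorm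
  have hMm : Measurable M := by
    have h1 := measurable_snd_spacetime (d := d)
    have h2 := (continuous_l1norm (d := d)).measurable
    have h3 := continuous_bracket.measurable
    have h4 := hkm.measurable
    fun_prop
  -- The condition 1 - b' ≤ b holds because b' ≥ b > 1/2.
  have hmain := lintegral_sq_schrodinger_wave_le hd hb (a := 1 - b') (by linarith) hd'
    (abs_hWave_le pm) (abs_hWave_sub_le pm) hVm hMm
  have hNv : bourgainNorm hSchr 0 b v ^ 2 =
      ∫⁻ ζ : Spacetime d, (bracketPow b (ζ.fst + ‖ζ.snd‖ ^ 2) * V ζ) ^ 2 := by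
    rw [sq_bourgainNorm hg]
    simp [hSchr, bracketPow, hV]
  have hNm : bourgainNorm (hWave pm) 1 b m' ^ 2 =
      ∫⁻ η : Spacetime d, (bracketPow b (η.fst - hWave pm η.snd) * M η) ^ 2 := by
    rw [sq_bourgainNorm hk']
    refine lintegral_congr fun η => ?_
    have h1 : bracketPow 1 ‖η.snd‖ = ENNReal.ofReal (bracket ‖η.snd‖) := by simp [bracketPow]
    rw [h1, enorm_mul, ← ofReal_norm ((Real.exp (σ * l1norm η.snd) : ℝ) : ℂ),
      Complex.norm_real, Real.norm_of_nonneg (Real.exp_pos _).le]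
    simp only [hM]
    ring
  set κ : ℝ≥0∞ := ENNReal.ofReal (fourierConst d * (σ * d)) with hκ
  have hκR : κ ^ 2 * (27 * resonanceConst d (2 * b)) ≤
      ENNReal.ofReal (fourierConst d * d * (√R + 1) * σ) ^ 2 := by
    rw [← ENNReal.ofReal_toReal hRtop, hκ, ← ENNReal.ofReal_pow (by positivity),
      ← ENNReal.ofReal_pow (by positivity), ← ENNReal.ofReal_mul (by positivity)]
    refine ENNReal.ofReal_le_ofReal ?_
    rw [← hR]
    have h1 : R ≤ (√R + 1) ^ 2 := by nlinarith [Real.sq_sqrt hRnn, Real.sqrt_nonneg R]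
    calc _ ≤ (fourierConst d * (σ * d)) ^ 2 * (√R + 1) ^ 2 := by gcongr
      _ = _ := by ring
  refine (ENNReal.pow_right_strictMono two_ne_zero).le_iff_le.1 ?_
  show _ ^ 2 ≤ _ ^ 2
  rw [sq_bourgainNorm_conj hG, mul_pow, mul_pow, hNv, hNm]
  calc _ ≤ ∫⁻ ζ : Spacetime d, κ ^ 2 * (bracketPow (-(1 - b')) (ζ.fst - ‖ζ.snd‖ ^ 2) *
        ∫⁻ η, V (ζ - η) * M η) ^ 2 := by
        refine lintegral_mono fun ζ => ?_
        rw [← mul_pow, neg_sub]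
        refine pow_le_pow_left' ?_ 2
        rw [mul_left_comm]
        gcongr
        exact hbound ζ
    _ = κ ^ 2 * ∫⁻ ζ : Spacetime d, (bracketPow (-(1 - b')) (ζ.fst - ‖ζ.snd‖ ^ 2) *
        ∫⁻ η, V (ζ - η) * M η) ^ 2 :=
        lintegral_const_mul' _ _ (ENNReal.pow_ne_top ENNReal.ofReal_ne_top)
    _ ≤ κ ^ 2 * _ := mul_le_mul' le_rfl hmain
    _ = κ ^ 2 * (27 * resonanceConst d (2 * b)) * _ * _ := by rw [← mul_assoc, ← mul_assoc]
    _ ≤ _ := by gcongr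

end GevreyBourgain

open GevreyBourgain
theorem lemma4p3 (d : ℕ) (hd : d = 1 ∨ d = 2 ∨ d = 3) (b b' : ℝ) (hb : 1 / 2 < b) (hbb' : b ≤ b')
    (hb' : b' < min ((6 - (d : ℝ)) / 4) 1) :
    ∃ C : ℝ, 0 < C ∧ ∀ σ : ℝ, 0 ≤ σ → ∀ (pm : PM) (v m : 𝓢'(Spacetime d, ℂ)),
      bourgainNorm hSchr 0 b v < ∞ → gevreyBourgainNorm (hWave pm) σ 1 b m < ∞ →
        (∃! F : 𝓢'(Spacetime d, ℂ), IsCommutator σ v m F) ∧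
        ∀ F : 𝓢'(Spacetime d, ℂ), IsCommutator σ v m F →
          bourgainNorm hSchr 0 (b' - 1) (conjDistribution F) ≤
            ENNReal.ofReal (C * σ) * bourgainNorm hSchr 0 b v *
              gevreyBourgainNorm (hWave pm) σ 1 b m := by
  obtain ⟨h1, h2⟩ := lt_min_iff.1 hb'
  -- The subtraction is truncated: for d ≤ 2 this says b' ≤ 1, and for d = 3 it says b' ≤ 3/4.
  have hd' : ((d - 2 : ℕ) : ℝ) ≤ 4 * (1 - b') := by
    rcases hd with rfl | rfl | rfl <;> norm_num at h1 ⊢ <;> linarith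
  obtain ⟨C, hC, hest⟩ := exists_commutator_estimate (by omega : d ≠ 0) hb hbb' hd'
  refine ⟨C, hC, fun σ hσ pm v m hv hm => ?_⟩
  obtain ⟨F, hF, hle⟩ := hest σ hσ pm v m hv hm
  refine ⟨⟨F, hF, fun F' hF' => hF'.unique hF⟩, fun F' hF' => ?_⟩
  rwa [hF'.unique hF]
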